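/- Let $k$ be a field of characteristic not two or three, let $\Gamma$ be an abelian group and let $\epsilon:\Gamma\times\Gamma\to k^*$ be a commutation factor: $\epsilon(a,b)\epsilon(b,a)=1$ and $\epsilon$ is additive-to-multiplicative in each variable. For homogeneous vectors $v,w$ of $\Gamma$-graded spaces write $\epsilon(v,w)=\epsilon(|v|,|w|)$; all formulas below involving degrees are for homogeneous vectors and are extended linearly. Bilinear forms with values in $k$ are of degree $0$. **Alternating maps.** For a $\Gamma$-graded space $V$, $\sigma\in S_n$ and $v_1,\dots,v_n\in V$ put $$p(\sigma;v_1,\dots,v_n)=\mathrm{sgn}(\sigma)\prod_{i<j,\ \sigma^{-1}(i)>\sigma^{-1}(j)}\epsilon(v_i,v_j),\qquad (\tilde\pi(\sigma)f)(v_1,\dots,v_n)=p(\sigma;v_1,\dots,v_n)\,f(v_{\sigma(1)},\dots,v_{\sigma(n)}).$$ $Alt^n_\epsilon(V,W)$ is the space of multilinear maps $f:V^n\to W$ with $\tilde\pi(\sigma)f=f$ for all $\sigma\in S_n$, and $Alt^n_\epsilon(V)=Alt^n_\epsilon(V,k)$. For a partition of $\{1,\dots,n\}$ into consecutive blocks,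 a shuffle is a permutation that is increasing on each block. If $f$ is $i$-linear and $g$ is $j$-linear on $V$, and $\phi$ is a bilinear map, then $f\wedge_\phi g=\sum_\sigma\tilde\pi(\sigma)\big(\phi(f(v_1,\dots,v_i),g(v_{i+1},\dots,v_{i+j}))\big)$, the sum being over the shuffles for the blocks $\{1,\dots,i\},\{i+1,\dots,i+j\}$. If $g$ is $V$-valued, then $f\circ g=\sum_\sigma\tilde\pi(\sigma)\big(f(g(v_1,\dots,v_j),\dots,g(v_{(i-1)j+1},\dots,v_{ij}))\big)$, the sum being over the shuffles for the $i$ consecutive blocks of length $j$. The symbol $\wedge_\times$ is used when $\phi$ is scalar multiplication $k\times W\to W$, $\wedge_\epsilon$ when $\phi$ is the product of $k$, and $\wedge_\rho$ when $\phi(x,v)=\rho(x)(v)$. **Representations.** A colour Lie algebra is a $\Gamma$-graded space $\mathfrak g$ with a bilinear bracket such that $\{\mathfrak g_a,\mathfrak g_b\}\subseteq\mathfrak g_{a+b}$, $\{x,y\}=-\epsilon(x,y)\{y,x\}$ and $\epsilon(z,x)\{x,\{y,z\}\}+\epsilon(x,y)\{y,\{z,x\}\}+\epsilon(y,z)\{z,\{x,y\}\}=0$.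 It is $\epsilon$-quadratic if it is equipped with a non-degenerate bilinear form $B_{\mathfrak g}$ that is $\epsilon$-symmetric ($B_{\mathfrak g}(x,y)=\epsilon(x,y)B_{\mathfrak g}(y,x)$) and satisfies $B_{\mathfrak g}(\{x,y\},z)=-\epsilon(x,y)B_{\mathfrak g}(y,\{x,z\})$. Let $V$ be a finite-dimensional $\Gamma$-graded space with a non-degenerate $\epsilon$-symmetric form $(\ ,\ )$. Let $\mathfrak{so}_\epsilon(V)=\bigoplus_\gamma\mathfrak{so}_\epsilon(V)_\gamma$, where $\mathfrak{so}_\epsilon(V)_\gamma$ consists of the $f\in End(V)$ of degree $\gamma$ with $(f(v),w)+\epsilon(f,v)(v,f(w))=0$, with bracket $\{f,g\}=fg-\epsilon(f,g)gf$. An $\epsilon$-orthogonal representation is a linear map $\rho:\mathfrak g\to\mathfrak{so}_\epsilon(V)$ of degree $0$ preserving brackets. Its moment map $\mu:V\times V\to\mathfrak g$ is defined by $B_{\mathfrak g}(x,\mu(v,w))=(\rho(x)(v),w)$ for all $x\in\mathfrak g$. Let $\mu_{can}$ be the moment map of the fundamental representation of $\mathfrak{so}_\epsilon(V)$ with the form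 $-\frac12Tr(\mathcal E fg)$, where $\mathcal E(v)=\epsilon(v,v)v$; explicitly $\mu_{can}(u,v)(w)=\epsilon(v,w)(u,w)v-(v,w)u$. Write $x(v)$ for $\rho(x)(v)$, and for $m=\mu,\mu_{can}$ put $R_m(A,B,C,D)=(m(A,B)(C),D)$; put $\beta(R)(A,B,C,D)=R(A,B,C,D)+\epsilon(A,B+C)R(B,C,A,D)+\epsilon(A+B,C)R(C,A,B,D)$, where $\epsilon(A,B+C)=\epsilon(A,B)\epsilon(A,C)$, etc. The representation is special if $R_\mu-\frac13\beta(R_\mu)=R_{\mu_{can}}$. Its covariants are $\mu$, $$\psi(v_1,v_2,v_3)=\mu(v_1,v_2)(v_3)+\epsilon(v_1+v_2,v_3)\mu(v_3,v_1)(v_2)+\epsilon(v_1,v_2+v_3)\mu(v_2,v_3)(v_1),$$ $$\begin{aligned}Q(v_1,v_2,v_3,v_4)={}&(v_1,\psi(v_2,v_3,v_4))-\epsilon(v_1+v_2+v_3,v_4)(v_4,\psi(v_1,v_2,v_3))\\&+\epsilon(v_1+v_2,v_3+v_4)(v_3,\psi(v_4,v_1,v_2))-\epsilon(v_1,v_2+v_3+v_4)(v_2,\psi(v_3,v_4,v_1)).\end{aligned}$$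 **Theorem.** Let $\rho:\mathfrak g\to\mathfrak{so}_\epsilon(V)$ be a finite-dimensional special $\epsilon$-orthogonal representation of a finite-dimensional $\epsilon$-quadratic colour Lie algebra. Then $\mu\in Alt^2_\epsilon(V,\mathfrak g)$, $\psi\in Alt^3_\epsilon(V,V)$, $Q\in Alt^4_\epsilon(V)$, and the following identities hold, both sides being in the indicated spaces: a) $\mu\wedge_\rho\psi=-\frac32\,Q\wedge_\times Id_V$ in $Alt^5_\epsilon(V,V)$; b) $\mu\circ\psi=3\,Q\wedge_\times\mu$ in $Alt^6_\epsilon(V,\mathfrak g)$; c) $\psi\circ\psi=-\frac{27}2\,(Q\wedge_\epsilon Q)\wedge_\times Id_V$ in $Alt^9_\epsilon(V,V)$; d) $Q\circ\psi=54\,(Q\wedge_\epsilon Q)\wedge_\epsilon Q$ in $Alt^{12}_\epsilon(V,k)$. -/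

import Mathlib

namespace ColourLie

noncomputable section

set_option linter.unusedSectionVars false

/-- A commutation factor of the abelian group `Γ` with values in `k`. -/
structure CommutationFactor (Γ k : Type*) [AddCommGroup Γ] [Field k] where
  toFun : Γ → Γ → kˣ
  mul_swap : ∀ a b, toFun a b * toFun b a = 1
  map_add_left : ∀ a b c, toFun (a + b) c = toFun a c * toFun b c
  map_add_right : ∀ a b c, toFun a (b + c) = toFun a b * toFun a c

instance {Γ k : Type*} [AddCommGroup Γ] [Field k] :
    CoeFun (CommutationFactor Γ k) (fun _ => Γ → Γ → kˣ) :=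
  ⟨CommutationFactor.toFun⟩

section Multilinear

variable {k Γ V U W T : Type*} [Field k] [AddCommGroup Γ] [DecidableEq Γ]
  [AddCommGroup V] [Module k V] [AddCommGroup U] [Module k U] [AddCommGroup W] [Module k W]
  [AddCommGroup T] [Module k T]

/-- The multilinear map obtained by extending linearly the formula `c(|v₁|, …, |vₙ|) f(v₁, …, vₙ)`
for homogeneous `v₁, …, vₙ` (see `twist_apply`). -/
def twist {n : ℕ} (𝒱 : Γ → Submodule k V) [DirectSum.Decomposition 𝒱]
    (c : (Fin n → Γ) → k) (f : MultilinearMap k (fun _ : Fin n => V) W) :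
    MultilinearMap k (fun _ : Fin n => V) W :=
  (MultilinearMap.fromDirectSumEquiv
      (fun γ : Fin n → Γ => c γ • f.compLinearMap (fun i => (𝒱 (γ i)).subtype))).compLinearMap
    (fun _ => (DirectSum.decomposeLinearEquiv 𝒱).toLinearMap)

theorem twist_apply {n : ℕ} (𝒱 : Γ → Submodule k V) [DirectSum.Decomposition 𝒱]
    (c : (Fin n → Γ) → k) (f : MultilinearMap k (fun _ : Fin n => V) W)
    (γ : Fin n → Γ) (v : Fin n → V) (hv : ∀ i, v i ∈ 𝒱 (γ i)) :
    twist 𝒱 c f v = c γ • f v := by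
  have h : ∀ i, DirectSum.decomposeLinearEquiv 𝒱 (v i)
      = DirectSum.lof k Γ (fun g => 𝒱 g) (γ i) ⟨v i, hv i⟩ := fun i =>
    DirectSum.decomposeLinearEquiv_apply_coe 𝒱 (γ i) ⟨v i, hv i⟩
  simp only [twist, MultilinearMap.compLinearMap_apply, LinearEquiv.coe_coe, h]
  rw [MultilinearMap.fromDirectSumEquiv_lof]
  simp

/-- The multiplier `p(σ; v₁, …, vₙ)` for homogeneous `vᵢ` of degree `γᵢ`. -/
def multiplier {n : ℕ} (ε : CommutationFactor Γ k) (σ : Equiv.Perm (Fin n)) (γ : Fin n → Γ) : k :=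
  ((Equiv.Perm.sign σ : ℤ) : k) *
    ∏ q ∈ Finset.univ.filter (fun q : Fin n × Fin n => q.1 < q.2 ∧ σ⁻¹ q.2 < σ⁻¹ q.1),
      (ε (γ q.1) (γ q.2) : k)

/-- The action of the symmetric group on multilinear maps: for homogeneous `v₁, …, vₙ` it is
`p(σ; v₁, …, vₙ) f(v_{σ(1)}, …, v_{σ(n)})`. -/
def permAct {n : ℕ} (ε : CommutationFactor Γ k) (𝒱 : Γ → Submodule k V)
    [DirectSum.Decomposition 𝒱] (σ : Equiv.Perm (Fin n))
    (f : MultilinearMap k (fun _ : Fin n => V) W) : MultilinearMap k (fun _ : Fin n => V) W :=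
  twist 𝒱 (multiplier ε σ) (f.domDomCongr σ)

theorem permAct_apply {n : ℕ} (ε : CommutationFactor Γ k) (𝒱 : Γ → Submodule k V)
    [DirectSum.Decomposition 𝒱] (σ : Equiv.Perm (Fin n))
    (f : MultilinearMap k (fun _ : Fin n => V) W)
    (γ : Fin n → Γ) (v : Fin n → V) (hv : ∀ i, v i ∈ 𝒱 (γ i)) :
    permAct ε 𝒱 σ f v = multiplier ε σ γ • f (fun i => v (σ i)) := by
  rw [permAct, twist_apply 𝒱 _ _ γ v hv]
  rfl

/-- `Alt^n_ε(V, W)`: the multilinear maps `V^n → W` fixed by the action of the symmetric group. -/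
def IsAlt {n : ℕ} (ε : CommutationFactor Γ k) (𝒱 : Γ → Submodule k V)
    [DirectSum.Decomposition 𝒱] (f : MultilinearMap k (fun _ : Fin n => V) W) : Prop :=
  ∀ σ : Equiv.Perm (Fin n), permAct ε 𝒱 σ f = f

/-- The shuffles of `{1, …, n}` for the partition into the fibres of `b`: the permutations which
are increasing on every block. -/
def shuffles {n : ℕ} (b : Fin n → ℕ) : Finset (Equiv.Perm (Fin n)) :=
  Finset.univ.filter (fun σ => ∀ x y, b x = b y → x < y → σ x < σ y)

/-- The identity map of `V` as a `1`-linear map. -/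
def idMap (k V : Type*) [Field k] [AddCommGroup V] [Module k V] :
    MultilinearMap k (fun _ : Fin 1 => V) V :=
  MultilinearMap.ofSubsingleton k V V 0 LinearMap.id

/-- `(v₁, …, v_{i+j}) ↦ φ(f(v₁, …, vᵢ), g(v_{i+1}, …, v_{i+j}))`. -/
def prodMap {i j : ℕ} (φ : U →ₗ[k] W →ₗ[k] T) (f : MultilinearMap k (fun _ : Fin i => V) U)
    (g : MultilinearMap k (fun _ : Fin j => V) W) :
    MultilinearMap k (fun _ : Fin (i + j) => V) T :=
  (TensorProduct.lift φ).compMultilinearMap ((f.domCoprod g).domDomCongr finSumFinEquiv)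

theorem prodMap_apply {i j : ℕ} (φ : U →ₗ[k] W →ₗ[k] T)
    (f : MultilinearMap k (fun _ : Fin i => V) U) (g : MultilinearMap k (fun _ : Fin j => V) W)
    (v : Fin (i + j) → V) :
    prodMap φ f g v = φ (f (fun a => v (Fin.castAdd j a))) (g (fun a => v (Fin.natAdd i a))) := by
  simp [prodMap]

/-- The exterior product `f ∧_φ g`. -/
def wedge {i j : ℕ} (ε : CommutationFactor Γ k) (𝒱 : Γ → Submodule k V)
    [DirectSum.Decomposition 𝒱] (φ : U →ₗ[k] W →ₗ[k] T)
    (f : MultilinearMap k (fun _ : Fin i => V) U) (g : MultilinearMap k (fun _ : Fin j => V) W) :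
    MultilinearMap k (fun _ : Fin (i + j) => V) T :=
  ∑ σ ∈ shuffles (fun a : Fin (i + j) => if (a : ℕ) < i then 0 else 1),
    permAct ε 𝒱 σ (prodMap φ f g)

/-- The exterior product `f ∧_× g` of a scalar valued `f` and a vector valued `g`, taken with
respect to scalar multiplication; for `W = k` this is the product `∧_ε`. -/
def wedgeSmul {i j : ℕ} (ε : CommutationFactor Γ k) (𝒱 : Γ → Submodule k V)
    [DirectSum.Decomposition 𝒱] (f : MultilinearMap k (fun _ : Fin i => V) k)
    (g : MultilinearMap k (fun _ : Fin j => V) W) :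
    MultilinearMap k (fun _ : Fin (i + j) => V) W :=
  wedge ε 𝒱 (LinearMap.lsmul k W : k →ₗ[k] W →ₗ[k] W) f g

/-- `(v₁, …, v_{ij}) ↦ f(g(v₁, …, vⱼ), g(v_{j+1}, …, v_{2j}), …, g(v_{(i-1)j+1}, …, v_{ij}))`. -/
def compMap {i j : ℕ} (f : MultilinearMap k (fun _ : Fin i => V) U)
    (g : MultilinearMap k (fun _ : Fin j => W) V) :
    MultilinearMap k (fun _ : Fin (i * j) => W) U :=
  (f.compMultilinearMap (fun _ : Fin i => g)).domDomCongr
    ((Equiv.sigmaEquivProd (Fin i) (Fin j)).trans finProdFinEquiv)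

theorem compMap_apply {i j : ℕ} (f : MultilinearMap k (fun _ : Fin i => V) U)
    (g : MultilinearMap k (fun _ : Fin j => W) V) (v : Fin (i * j) → W) :
    compMap f g v = f (fun r => g (fun s => v (finProdFinEquiv (r, s)))) :=
  rfl

/-- The exterior composition `f ∘ g`. -/
def extComp {i j : ℕ} (ε : CommutationFactor Γ k) (𝒲 : Γ → Submodule k W)
    [DirectSum.Decomposition 𝒲] (f : MultilinearMap k (fun _ : Fin i => V) U)
    (g : MultilinearMap k (fun _ : Fin j => W) V) :
    MultilinearMap k (fun _ : Fin (i * j) => W) U :=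
  ∑ σ ∈ shuffles (fun a : Fin (i * j) => (a : ℕ) / j), permAct ε 𝒲 σ (compMap f g)

end Multilinear

section Algebra

variable {k Γ V L : Type*} [Field k] [AddCommGroup Γ] [DecidableEq Γ]
  [AddCommGroup V] [Module k V] [AddCommGroup L] [Module k L]

/-- A bilinear form with values in `k` which is `ε`-symmetric (and of degree `0`). -/
structure IsEpsSymm (ε : CommutationFactor Γ k) (𝒱 : Γ → Submodule k V)
    (B : V →ₗ[k] V →ₗ[k] k) : Prop where
  degree_zero : ∀ a b, a + b ≠ 0 → ∀ v ∈ 𝒱 a, ∀ w ∈ 𝒱 b, B v w = 0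
  symm : ∀ a b, ∀ v ∈ 𝒱 a, ∀ w ∈ 𝒱 b, B v w = (ε a b : k) * B w v

/-- A colour Lie algebra structure on the `Γ`-graded vector space `L = ⨁ 𝔤 γ`. -/
structure ColourLieAlgebra (ε : CommutationFactor Γ k) (𝔤 : Γ → Submodule k L) where
  bracket : L →ₗ[k] L →ₗ[k] L
  bracket_mem : ∀ a b, ∀ x ∈ 𝔤 a, ∀ y ∈ 𝔤 b, bracket x y ∈ 𝔤 (a + b)
  antisymm : ∀ a b, ∀ x ∈ 𝔤 a, ∀ y ∈ 𝔤 b, bracket x y = -((ε a b : k) • bracket y x)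
  jacobi : ∀ a b c, ∀ x ∈ 𝔤 a, ∀ y ∈ 𝔤 b, ∀ z ∈ 𝔤 c,
    (ε c a : k) • bracket x (bracket y z) + (ε a b : k) • bracket y (bracket z x)
      + (ε b c : k) • bracket z (bracket x y) = 0

/-- An `ε`-quadratic colour Lie algebra. -/
structure QuadraticColourLieAlgebra (ε : CommutationFactor Γ k) (𝔤 : Γ → Submodule k L) extends
    ColourLieAlgebra ε 𝔤 where
  form : L →ₗ[k] L →ₗ[k] k
  form_symm : IsEpsSymm ε 𝔤 form
  form_nondegenerate : form.Nondegenerate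
  ad_invariant : ∀ a b c, ∀ x ∈ 𝔤 a, ∀ y ∈ 𝔤 b, ∀ z ∈ 𝔤 c,
    form (bracket x y) z = -((ε a b : k) * form y (bracket x z))

/-- The component of degree `γ` of `𝔰𝔬_ε(V, ( , ))`. -/
def soComponent (ε : CommutationFactor Γ k) (𝒱 : Γ → Submodule k V)
    (B : V →ₗ[k] V →ₗ[k] k) (γ : Γ) : Submodule k (Module.End k V) where
  carrier := {f | (∀ a, ∀ v ∈ 𝒱 a, f v ∈ 𝒱 (a + γ)) ∧
    ∀ a, ∀ v ∈ 𝒱 a, ∀ w, B (f v) w + (ε γ a : k) * B v (f w) = 0}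
  zero_mem' := by simp
  add_mem' := by
    rintro f g ⟨hf, hf'⟩ ⟨hg, hg'⟩
    refine ⟨fun a v hv => Submodule.add_mem _ (hf a v hv) (hg a v hv), fun a v hv w => ?_⟩
    have h1 := hf' a v hv w
    have h2 := hg' a v hv w
    simp only [LinearMap.add_apply, map_add]
    linear_combination h1 + h2
  smul_mem' := by
    rintro c f ⟨hf, hf'⟩
    refine ⟨fun a v hv => Submodule.smul_mem _ _ (hf a v hv), fun a v hv w => ?_⟩
    have h1 := hf' a v hv w
    simp only [LinearMap.smul_apply, map_smul, smul_eq_mul]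
    linear_combination c * h1

/-- The space `𝔰𝔬_ε(V, ( , ))`, the sum of its homogeneous components. -/
def so (ε : CommutationFactor Γ k) (𝒱 : Γ → Submodule k V) (B : V →ₗ[k] V →ₗ[k] k) :
    Submodule k (Module.End k V) :=
  ⨆ γ, soComponent ε 𝒱 B γ

/-- An `ε`-orthogonal representation of a colour Lie algebra on `V = ⨁ 𝒱 γ`: a non-degenerate
`ε`-symmetric form on `V` and a morphism of colour Lie algebras to `𝔰𝔬_ε(V, ( , ))`, whose bracket
is `{f, g} = f g - ε(f, g) g f`. -/
structure OrthogonalRep {ε : CommutationFactor Γ k} {𝔤 : Γ → Submodule k L}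
    (A : ColourLieAlgebra ε 𝔤) (𝒱 : Γ → Submodule k V) where
  form : V →ₗ[k] V →ₗ[k] k
  form_symm : IsEpsSymm ε 𝒱 form
  form_nondegenerate : form.Nondegenerate
  rho : L →ₗ[k] Module.End k V
  rho_mem : ∀ a, ∀ x ∈ 𝔤 a, rho x ∈ soComponent ε 𝒱 form a
  rho_bracket : ∀ a b, ∀ x ∈ 𝔤 a, ∀ y ∈ 𝔤 b,
    rho (A.bracket x y) = rho x * rho y - (ε a b : k) • (rho y * rho x)

/-- The moment map attached to a linear map `ρ : L → End(V)`, a non-degenerate form on `L` and a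
form on `V`; it is characterised by `momentMap_spec`. -/
def momentMap [FiniteDimensional k L] (BL : L →ₗ[k] L →ₗ[k] k) (hBL : BL.Nondegenerate)
    (BV : V →ₗ[k] V →ₗ[k] k) (ρ : L →ₗ[k] Module.End k V) : V →ₗ[k] V →ₗ[k] L :=
  LinearMap.mk₂ k
    (fun v w => (LinearMap.BilinForm.toDual BL.flip (LinearMap.flip_nondegenerate.2 hBL)).symm (BV.flip w ∘ₗ ρ.flip v))
    (fun v v' w => by rw [← map_add]; congr 1; ext; simp)
    (fun c v w => by rw [← map_smul]; congr 1; ext; simp)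
    (fun v w w' => by rw [← map_add]; congr 1; ext; simp)
    (fun c v w => by rw [← map_smul]; congr 1; ext; simp)

theorem momentMap_spec [FiniteDimensional k L] (BL : L →ₗ[k] L →ₗ[k] k) (hBL : BL.Nondegenerate)
    (BV : V →ₗ[k] V →ₗ[k] k) (ρ : L →ₗ[k] Module.End k V) (x : L) (v w : V) :
    BL x (momentMap BL hBL BV ρ v w) = BV (ρ x v) w := by
  have h := LinearMap.BilinForm.apply_toDual_symm_apply (B := BL.flip) (hB := (LinearMap.flip_nondegenerate.2 hBL))
    (BV.flip w ∘ₗ ρ.flip v) x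
  simpa [momentMap] using h

/-- The map `𝓔(v) = ε(v, v) v`. -/
def epsMap (ε : CommutationFactor Γ k) (𝒱 : Γ → Submodule k V) [DirectSum.Decomposition 𝒱] :
    Module.End k V :=
  DirectSum.toModule k Γ V (fun γ => (ε γ γ : k) • (𝒱 γ).subtype) ∘ₗ
    (DirectSum.decomposeLinearEquiv 𝒱).toLinearMap

theorem epsMap_apply (ε : CommutationFactor Γ k) (𝒱 : Γ → Submodule k V)
    [DirectSum.Decomposition 𝒱] (a : Γ) (v : V) (hv : v ∈ 𝒱 a) :
    epsMap ε 𝒱 v = (ε a a : k) • v := by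
  have h := DirectSum.decomposeLinearEquiv_apply_coe 𝒱 a ⟨v, hv⟩
  simp only at h
  simp [epsMap, h]

/-- The form `-(1/2) Tr_ε(f g)` on `𝔰𝔬_ε(V, ( , ))`, where `Tr_ε(f) = Tr(𝓔 ∘ f)`. -/
def soForm (ε : CommutationFactor Γ k) (𝒱 : Γ → Submodule k V) [DirectSum.Decomposition 𝒱]
    (B : V →ₗ[k] V →ₗ[k] k) : so ε 𝒱 B →ₗ[k] so ε 𝒱 B →ₗ[k] k :=
  LinearMap.mk₂ k
    (fun f g => -(1 / 2 : k) * LinearMap.trace k V (epsMap ε 𝒱 * ((f : Module.End k V) * g)))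
    (fun f f' g => by simp [mul_add, add_mul])
    (fun c f g => by simp; ring)
    (fun f g g' => by simp [mul_add])
    (fun c f g => by simp; ring)

theorem CommutationFactor.neg_right (ε : CommutationFactor Γ k) (a b : Γ) : ε a (-b) = ε b a := by
  have h0 : ε a 0 = 1 := by
    have h := ε.map_add_right a 0 0
    rw [add_zero] at h
    exact left_eq_mul.mp h
  have h1 : ε a (-b) * ε a b = 1 := by rw [← ε.map_add_right, neg_add_cancel, h0]
  rw [eq_inv_of_mul_eq_one_left h1, ← eq_inv_of_mul_eq_one_left (ε.mul_swap b a)]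

theorem CommutationFactor.neg_left (ε : CommutationFactor Γ k) (a b : Γ) : ε (-a) b = ε b a := by
  have h := ε.mul_swap (-a) b
  rw [ε.neg_right] at h
  rw [eq_inv_of_mul_eq_one_left h, ← eq_inv_of_mul_eq_one_left (ε.mul_swap b a)]

/-- The endomorphism `w ↦ ε(v, w)(u, w) v - (v, w) u` for homogeneous `u, v` of degrees `a, b`
(note that `ε(v, w) = ε(u, v)` if `(u, w) ≠ 0`). -/
def rankTwo (ε : CommutationFactor Γ k) (B : V →ₗ[k] V →ₗ[k] k) (a b : Γ) (u v : V) :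
    Module.End k V :=
  (ε a b : k) • (B u).smulRight v - (B v).smulRight u

theorem rankTwo_mem (ε : CommutationFactor Γ k) (𝒱 : Γ → Submodule k V)
    (B : V →ₗ[k] V →ₗ[k] k) (hB : IsEpsSymm ε 𝒱 B) (a b : Γ) (u v : V) (hu : u ∈ 𝒱 a)
    (hv : v ∈ 𝒱 b) : rankTwo ε B a b u v ∈ soComponent ε 𝒱 B (a + b) := by
  refine ⟨fun c w hw => ?_, fun c w hw y => ?_⟩
  · have h1 : (B u w) • v ∈ 𝒱 (c + (a + b)) := by
      by_cases h : a + c = 0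
      · have : c + (a + b) = b := by rw [← add_assoc, add_comm c a, h, zero_add]
        rw [this]; exact Submodule.smul_mem _ _ hv
      · rw [hB.degree_zero a c h u hu w hw, zero_smul]; exact Submodule.zero_mem _
    have h2 : (B v w) • u ∈ 𝒱 (c + (a + b)) := by
      by_cases h : b + c = 0
      · have : c + (a + b) = a := by rw [add_comm a b, ← add_assoc, add_comm c b, h, zero_add]
        rw [this]; exact Submodule.smul_mem _ _ hu
      · rw [hB.degree_zero b c h v hv w hw, zero_smul]; exact Submodule.zero_mem _
    simpa [rankTwo] using Submodule.sub_mem _ (Submodule.smul_mem _ (ε a b : k) h1) h2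
  · have h1 : (ε a b : k) * B u w = (ε (a + b) c : k) * B w u := by
      rw [hB.symm a c u hu w hw]
      by_cases h : c + a = 0
      · have hc : c = -a := eq_neg_of_add_eq_zero_left h
        rw [ε.map_add_left, hc, ε.neg_right b a, Units.val_mul]; ring
      · rw [hB.degree_zero c a h w hw u hu]; ring
    have h2 : B v w = (ε (a + b) c : k) * (ε a b : k) * B w v := by
      rw [hB.symm b c v hv w hw]
      by_cases h : c + b = 0
      · have hc : c = -b := eq_neg_of_add_eq_zero_left h
        have h3 : ((ε b a : kˣ) : k) * (ε a b : k) = 1 := by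
          rw [← Units.val_mul, ε.mul_swap, Units.val_one]
        rw [ε.map_add_left, hc, ε.neg_right a b, Units.val_mul]
        linear_combination -((ε b (-b) : kˣ) : k) * B w v * h3
      · rw [hB.degree_zero c b h w hw v hv]; ring
    simp only [rankTwo, LinearMap.sub_apply, LinearMap.smul_apply, LinearMap.smulRight_apply,
      map_sub, map_smul, smul_eq_mul]
    linear_combination B v y * h1 - B u y * h2

theorem trace_rankTwo [FiniteDimensional k V] (ε : CommutationFactor Γ k)
    (𝒱 : Γ → Submodule k V) [DirectSum.Decomposition 𝒱]
    (B : V →ₗ[k] V →ₗ[k] k) (hB : IsEpsSymm ε 𝒱 B) (a b : Γ) (u v : V) (hu : u ∈ 𝒱 a)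
    (hv : v ∈ 𝒱 b) (f : Module.End k V) (hf : f ∈ so ε 𝒱 B) :
    LinearMap.trace k V (epsMap ε 𝒱 * (f * rankTwo ε B a b u v)) = -(2 * B (f u) v) := by
  have key : epsMap ε 𝒱 * (f * rankTwo ε B a b u v) =
      (ε a b : k) • (B u).smulRight (epsMap ε 𝒱 (f v)) - (B v).smulRight (epsMap ε 𝒱 (f u)) := by
    ext w; simp [rankTwo]
  rw [key]
  simp only [map_sub, map_smul, LinearMap.trace_smulRight, smul_eq_mul]
  clear key
  refine Submodule.iSup_induction _ (motive := fun f : Module.End k V =>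
    (ε a b : k) * B u (epsMap ε 𝒱 (f v)) - B v (epsMap ε 𝒱 (f u)) = -(2 * B (f u) v)) hf
    ?_ (by simp) ?_
  · rintro γ f ⟨hf1, hf2⟩
    have hfu := hf1 a u hu
    have hfv := hf1 b v hv
    rw [epsMap_apply ε 𝒱 _ _ hfu, epsMap_apply ε 𝒱 _ _ hfv]
    simp only [map_smul, smul_eq_mul]
    by_cases h : a + b + γ = 0
    · have hγ : b + γ = -a := by
        rw [eq_neg_iff_add_eq_zero, ← h]; abel
      have hγ' : a + γ = -b := by
        rw [eq_neg_iff_add_eq_zero, ← h]; abel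
      have hγ'' : γ = -(a + b) := by
        rw [eq_neg_iff_add_eq_zero, ← h]; abel
      have e1 := hf2 a u hu v
      have e2 := hB.symm _ _ v hv (f u) hfu
      have ha : ((ε a a : kˣ) : k) * (ε a a : k) = 1 := by
        rw [← Units.val_mul, ε.mul_swap, Units.val_one]
      have hb : ((ε b b : kˣ) : k) * (ε b b : k) = 1 := by
        rw [← Units.val_mul, ε.mul_swap, Units.val_one]
      rw [hγ', ε.neg_right b b] at e2
      rw [hγ'', ε.neg_left, ε.map_add_right, Units.val_mul] at e1
      rw [hγ, hγ', ε.neg_right (-a) a, ε.neg_right (-b) b, ε.neg_right a a, ε.neg_right b b]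
      rw [e2]
      linear_combination e1 - B (f u) v * hb
    · have e1 : B u (f v) = 0 := hB.degree_zero _ _ (by rwa [← add_assoc]) u hu _ hfv
      have e2 : B v (f u) = 0 := hB.degree_zero _ _
        (by rwa [← add_assoc, add_comm b a]) v hv _ hfu
      have e3 : B (f u) v = 0 := hB.degree_zero _ _
        (by rwa [add_assoc, add_comm γ b, ← add_assoc]) _ hfu v hv
      rw [e1, e2, e3]; ring
  · intro f g hf hg
    simp only [LinearMap.add_apply, map_add]
    linear_combination hf + hg

theorem rankTwo_mem_so (ε : CommutationFactor Γ k) (𝒱 : Γ → Submodule k V)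
    (B : V →ₗ[k] V →ₗ[k] k) (hB : IsEpsSymm ε 𝒱 B) (a b : Γ) (u v : V) (hu : u ∈ 𝒱 a)
    (hv : v ∈ 𝒱 b) : rankTwo ε B a b u v ∈ so ε 𝒱 B :=
  (le_iSup (soComponent ε 𝒱 B) (a + b)) (rankTwo_mem ε 𝒱 B hB a b u v hu hv)

theorem soForm_rankTwo [FiniteDimensional k V] (h2 : (2 : k) ≠ 0) (ε : CommutationFactor Γ k)
    (𝒱 : Γ → Submodule k V) [DirectSum.Decomposition 𝒱]
    (B : V →ₗ[k] V →ₗ[k] k) (hB : IsEpsSymm ε 𝒱 B) (a b : Γ) (u v : V) (hu : u ∈ 𝒱 a)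
    (hv : v ∈ 𝒱 b) (f : so ε 𝒱 B) :
    soForm ε 𝒱 B f ⟨rankTwo ε B a b u v, rankTwo_mem_so ε 𝒱 B hB a b u v hu hv⟩
      = B ((f : Module.End k V) u) v := by
  have h := trace_rankTwo ε 𝒱 B hB a b u v hu hv f f.2
  simp only [soForm, LinearMap.mk₂_apply, h]
  field_simp

theorem hom_ext_homogeneous {W : Type*} [AddCommGroup W] [Module k W] (𝒱 : Γ → Submodule k V)
    [DirectSum.Decomposition 𝒱] {f g : V →ₗ[k] W} (h : ∀ a, ∀ v ∈ 𝒱 a, f v = g v) : f = g :=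
  DirectSum.decompose_lhom_ext 𝒱 (fun a => LinearMap.ext fun v => h a v v.2)

theorem soForm_nondegenerate [FiniteDimensional k V] (h2 : (2 : k) ≠ 0)
    (ε : CommutationFactor Γ k) (𝒱 : Γ → Submodule k V) [DirectSum.Decomposition 𝒱]
    (B : V →ₗ[k] V →ₗ[k] k) (hB : IsEpsSymm ε 𝒱 B) (hB' : B.Nondegenerate) :
    (soForm ε 𝒱 B).Nondegenerate := by
  refine LinearMap.BilinForm.Nondegenerate.ofSeparatingLeft (fun f hf => ?_)
  have h : B ∘ₗ (f : Module.End k V) = 0 := by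
    refine hom_ext_homogeneous 𝒱 (fun a u hu => hom_ext_homogeneous 𝒱 (fun b v hv => ?_))
    have := soForm_rankTwo h2 ε 𝒱 B hB a b u v hu hv f
    rw [hf] at this
    simpa using this.symm
  ext u
  simp only [ZeroMemClass.coe_zero, LinearMap.zero_apply]
  exact hB'.1 _ (fun w => by simpa using LinearMap.congr_fun (LinearMap.congr_fun h u) w)

/-- The canonical moment map: the moment map of the fundamental representation of
`𝔰𝔬_ε(V, ( , ))`, equipped with the form `-(1/2) Tr_ε(f g)`. -/
def muCan [FiniteDimensional k V] (h2 : (2 : k) ≠ 0)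
    (ε : CommutationFactor Γ k) (𝒱 : Γ → Submodule k V) [DirectSum.Decomposition 𝒱]
    (B : V →ₗ[k] V →ₗ[k] k) (hB : IsEpsSymm ε 𝒱 B) (hB' : B.Nondegenerate) :
    V →ₗ[k] V →ₗ[k] so ε 𝒱 B :=
  momentMap (soForm ε 𝒱 B) (soForm_nondegenerate h2 ε 𝒱 B hB hB') B (so ε 𝒱 B).subtype

theorem muCan_apply [FiniteDimensional k V] (h2 : (2 : k) ≠ 0)
    (ε : CommutationFactor Γ k) (𝒱 : Γ → Submodule k V) [DirectSum.Decomposition 𝒱]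
    (B : V →ₗ[k] V →ₗ[k] k) (hB : IsEpsSymm ε 𝒱 B) (hB' : B.Nondegenerate)
    (a b c : Γ) (u v w : V) (hu : u ∈ 𝒱 a) (hv : v ∈ 𝒱 b) (hw : w ∈ 𝒱 c) :
    (muCan h2 ε 𝒱 B hB hB' u v : Module.End k V) w
      = ((ε b c : k) * B u w) • v - B v w • u := by
  have h : muCan h2 ε 𝒱 B hB hB' u v
      = ⟨rankTwo ε B a b u v, rankTwo_mem_so ε 𝒱 B hB a b u v hu hv⟩ := by
    rw [← sub_eq_zero]
    refine (soForm_nondegenerate h2 ε 𝒱 B hB hB').2 _ (fun f => ?_)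
    rw [map_sub, soForm_rankTwo h2 ε 𝒱 B hB a b u v hu hv f, muCan, momentMap_spec]
    simp
  have h1 : (ε a b : k) * B u w = (ε b c : k) * B u w := by
    by_cases h : a + c = 0
    · rw [eq_neg_of_add_eq_zero_right h, ε.neg_right]
    · rw [hB.degree_zero a c h u hu w hw, mul_zero, mul_zero]
  rw [h, ← h1]
  simp [rankTwo, smul_smul]

end Algebra

section Covariants

variable {k Γ V L : Type*} [Field k] [AddCommGroup Γ] [DecidableEq Γ]
  [AddCommGroup V] [Module k V] [AddCommGroup L] [Module k L]

/-- The trilinear map `(v₁, v₂, v₃) ↦ ρ(μ(v₁, v₂))(v₃)`. -/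
def triple (ρ : L →ₗ[k] Module.End k V) (μ : V →ₗ[k] V →ₗ[k] L) :
    MultilinearMap k (fun _ : Fin 3 => V) V :=
  prodMap (i := 2) (j := 1) ρ (prodMap (i := 1) (j := 1) μ (idMap k V) (idMap k V)) (idMap k V)

theorem triple_apply (ρ : L →ₗ[k] Module.End k V) (μ : V →ₗ[k] V →ₗ[k] L) (v : Fin 3 → V) :
    triple ρ μ v = ρ (μ (v 0) (v 1)) (v 2) := by
  rw [triple, prodMap_apply, prodMap_apply]
  rfl

/-- The map `R_μ(A, B, C, D) = (μ(A, B)(C), D)`. -/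
def curvature (BV : V →ₗ[k] V →ₗ[k] k) (ρ : L →ₗ[k] Module.End k V) (μ : V →ₗ[k] V →ₗ[k] L) :
    MultilinearMap k (fun _ : Fin 4 => V) k :=
  prodMap (i := 3) (j := 1) BV (triple ρ μ) (idMap k V)

theorem curvature_apply (BV : V →ₗ[k] V →ₗ[k] k) (ρ : L →ₗ[k] Module.End k V)
    (μ : V →ₗ[k] V →ₗ[k] L) (v : Fin 4 → V) :
    curvature BV ρ μ v = BV (ρ (μ (v 0) (v 1)) (v 2)) (v 3) := by
  rw [curvature, prodMap_apply, triple_apply]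
  rfl

/-- The Bianchi map `β(R)(A, B, C, D) = R(A, B, C, D) + ε(A, B + C) R(B, C, A, D)
+ ε(A + B, C) R(C, A, B, D)`. -/
def bianchi (ε : CommutationFactor Γ k) (𝒱 : Γ → Submodule k V) [DirectSum.Decomposition 𝒱]
    (R : MultilinearMap k (fun _ : Fin 4 => V) k) : MultilinearMap k (fun _ : Fin 4 => V) k :=
  R
  + twist 𝒱 (fun γ => (ε (γ 0) (γ 1 + γ 2) : k))
      (R.domDomCongr (Equiv.swap 0 1 * Equiv.swap 1 2))
  + twist 𝒱 (fun γ => (ε (γ 0 + γ 1) (γ 2) : k))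
      (R.domDomCongr (Equiv.swap 1 2 * Equiv.swap 0 1))

theorem bianchi_apply (ε : CommutationFactor Γ k) (𝒱 : Γ → Submodule k V)
    [DirectSum.Decomposition 𝒱] (R : MultilinearMap k (fun _ : Fin 4 => V) k)
    (a b c d : Γ) (A B C D : V) (hA : A ∈ 𝒱 a) (hB : B ∈ 𝒱 b) (hC : C ∈ 𝒱 c) (hD : D ∈ 𝒱 d) :
    bianchi ε 𝒱 R ![A, B, C, D] = R ![A, B, C, D] + (ε a (b + c) : k) * R ![B, C, A, D]
      + (ε (a + b) c : k) * R ![C, A, B, D] := by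
  have hv : ∀ i, (![A, B, C, D] : Fin 4 → V) i ∈ 𝒱 ((![a, b, c, d] : Fin 4 → Γ) i) := by
    intro i; fin_cases i <;> assumption
  rw [bianchi, add_apply, add_apply,
    twist_apply 𝒱 _ _ _ _ hv, twist_apply 𝒱 _ _ _ _ hv]
  have e1 : (fun i => (![A, B, C, D] : Fin 4 → V)
      ((Equiv.swap 0 1 * Equiv.swap 1 2 : Equiv.Perm (Fin 4)) i)) = ![B, C, A, D] := by
    funext i; fin_cases i <;> rfl
  have e2 : (fun i => (![A, B, C, D] : Fin 4 → V)
      ((Equiv.swap 1 2 * Equiv.swap 0 1 : Equiv.Perm (Fin 4)) i)) = ![C, A, B, D] := by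
    funext i; fin_cases i <;> rfl
  simp only [MultilinearMap.domDomCongr_apply, e1, e2]
  rfl

/-- The trilinear covariant `ψ(v₁, v₂, v₃) = μ(v₁, v₂)(v₃) + ε(v₁ + v₂, v₃) μ(v₃, v₁)(v₂)
+ ε(v₁, v₂ + v₃) μ(v₂, v₃)(v₁)`. -/
def psi (ε : CommutationFactor Γ k) (𝒱 : Γ → Submodule k V) [DirectSum.Decomposition 𝒱]
    (ρ : L →ₗ[k] Module.End k V) (μ : V →ₗ[k] V →ₗ[k] L) :
    MultilinearMap k (fun _ : Fin 3 => V) V :=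
  triple ρ μ
  + twist 𝒱 (fun γ => (ε (γ 0 + γ 1) (γ 2) : k)) ((triple ρ μ).domDomCongr (Equiv.addRight 2))
  + twist 𝒱 (fun γ => (ε (γ 0) (γ 1 + γ 2) : k)) ((triple ρ μ).domDomCongr (Equiv.addRight 1))

theorem psi_apply (ε : CommutationFactor Γ k) (𝒱 : Γ → Submodule k V)
    [DirectSum.Decomposition 𝒱] (ρ : L →ₗ[k] Module.End k V) (μ : V →ₗ[k] V →ₗ[k] L)
    (a b c : Γ) (u v w : V) (hu : u ∈ 𝒱 a) (hv : v ∈ 𝒱 b) (hw : w ∈ 𝒱 c) :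
    psi ε 𝒱 ρ μ ![u, v, w] = ρ (μ u v) w + (ε (a + b) c : k) • ρ (μ w u) v
      + (ε a (b + c) : k) • ρ (μ v w) u := by
  have h : ∀ i, (![u, v, w] : Fin 3 → V) i ∈ 𝒱 ((![a, b, c] : Fin 3 → Γ) i) := by
    intro i; fin_cases i <;> assumption
  rw [psi, add_apply, add_apply,
    twist_apply 𝒱 _ _ _ _ h, twist_apply 𝒱 _ _ _ _ h]
  simp only [MultilinearMap.domDomCongr_apply, triple_apply]
  rfl

/-- The quadrilinear covariant `Q(v₁, v₂, v₃, v₄) = (v₁, ψ(v₂, v₃, v₄))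
- ε(v₁ + v₂ + v₃, v₄) (v₄, ψ(v₁, v₂, v₃)) + ε(v₁ + v₂, v₃ + v₄) (v₃, ψ(v₄, v₁, v₂))
- ε(v₁, v₂ + v₃ + v₄) (v₂, ψ(v₃, v₄, v₁))`. -/
def quartic (ε : CommutationFactor Γ k) (𝒱 : Γ → Submodule k V) [DirectSum.Decomposition 𝒱]
    (BV : V →ₗ[k] V →ₗ[k] k) (ψ : MultilinearMap k (fun _ : Fin 3 => V) V) :
    MultilinearMap k (fun _ : Fin 4 => V) k :=
  let S : MultilinearMap k (fun _ : Fin 4 => V) k := prodMap (i := 1) (j := 3) BV (idMap k V) ψ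
  S
  - twist 𝒱 (fun γ => (ε (γ 0 + γ 1 + γ 2) (γ 3) : k)) (S.domDomCongr (Equiv.addRight 3))
  + twist 𝒱 (fun γ => (ε (γ 0 + γ 1) (γ 2 + γ 3) : k)) (S.domDomCongr (Equiv.addRight 2))
  - twist 𝒱 (fun γ => (ε (γ 0) (γ 1 + γ 2 + γ 3) : k)) (S.domDomCongr (Equiv.addRight 1))

theorem quartic_apply (ε : CommutationFactor Γ k) (𝒱 : Γ → Submodule k V)
    [DirectSum.Decomposition 𝒱] (BV : V →ₗ[k] V →ₗ[k] k)
    (ψ : MultilinearMap k (fun _ : Fin 3 => V) V)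
    (a b c d : Γ) (A B C D : V) (hA : A ∈ 𝒱 a) (hB : B ∈ 𝒱 b) (hC : C ∈ 𝒱 c) (hD : D ∈ 𝒱 d) :
    quartic ε 𝒱 BV ψ ![A, B, C, D] = BV A (ψ ![B, C, D])
      - (ε (a + b + c) d : k) * BV D (ψ ![A, B, C])
      + (ε (a + b) (c + d) : k) * BV C (ψ ![D, A, B])
      - (ε a (b + c + d) : k) * BV B (ψ ![C, D, A]) := by
  have hv : ∀ i, (![A, B, C, D] : Fin 4 → V) i ∈ 𝒱 ((![a, b, c, d] : Fin 4 → Γ) i) := by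
    intro i; fin_cases i <;> assumption
  have hS : ∀ v : Fin 4 → V, prodMap (i := 1) (j := 3) BV (idMap k V) ψ v
      = BV (v 0) (ψ ![v 1, v 2, v 3]) := by
    intro v
    rw [prodMap_apply]
    have e : (fun i : Fin 3 => v (Fin.natAdd 1 i)) = ![v 1, v 2, v 3] := by
      funext i; fin_cases i <;> rfl
    rw [e]
    rfl
  simp only [quartic]
  rw [sub_apply, add_apply, sub_apply,
    twist_apply 𝒱 _ _ _ _ hv, twist_apply 𝒱 _ _ _ _ hv, twist_apply 𝒱 _ _ _ _ hv]
  simp only [MultilinearMap.domDomCongr_apply, hS]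
  rfl

variable {ε : CommutationFactor Γ k} {𝔤 : Γ → Submodule k L} {𝒱 : Γ → Submodule k V}

/-- The moment map of an `ε`-orthogonal representation of an `ε`-quadratic colour Lie algebra:
`B_𝔤(x, μ(v, w)) = (ρ(x)(v), w)`. -/
def OrthogonalRep.moment [FiniteDimensional k L] {A : QuadraticColourLieAlgebra ε 𝔤}
    (r : OrthogonalRep A.toColourLieAlgebra 𝒱) : V →ₗ[k] V →ₗ[k] L :=
  momentMap A.form A.form_nondegenerate r.form r.rho

variable [DirectSum.Decomposition 𝒱]

/-- Special `ε`-orthogonal representations: `R_μ - (1/3) β(R_μ) = R_{μ_can}`. -/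
def OrthogonalRep.IsSpecial [FiniteDimensional k L] [FiniteDimensional k V] (h2 : (2 : k) ≠ 0)
    {A : QuadraticColourLieAlgebra ε 𝔤} (r : OrthogonalRep A.toColourLieAlgebra 𝒱) : Prop :=
  curvature r.form r.rho r.moment
      - (1 / 3 : k) • bianchi ε 𝒱 (curvature r.form r.rho r.moment)
    = curvature r.form (so ε 𝒱 r.form).subtype
        (muCan h2 ε 𝒱 r.form r.form_symm r.form_nondegenerate)

/-- The covariant `μ` as a multilinear map. -/
def OrthogonalRep.covMu [FiniteDimensional k L] {A : QuadraticColourLieAlgebra ε 𝔤}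
    (r : OrthogonalRep A.toColourLieAlgebra 𝒱) : MultilinearMap k (fun _ : Fin 2 => V) L :=
  prodMap (i := 1) (j := 1) r.moment (idMap k V) (idMap k V)

theorem OrthogonalRep.covMu_apply [FiniteDimensional k L] {A : QuadraticColourLieAlgebra ε 𝔤}
    (r : OrthogonalRep A.toColourLieAlgebra 𝒱) (v : Fin 2 → V) :
    r.covMu v = r.moment (v 0) (v 1) := by
  rw [covMu, prodMap_apply]
  rfl

/-- The covariant `ψ`. -/
def OrthogonalRep.covPsi [FiniteDimensional k L] {A : QuadraticColourLieAlgebra ε 𝔤}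
    (r : OrthogonalRep A.toColourLieAlgebra 𝒱) : MultilinearMap k (fun _ : Fin 3 => V) V :=
  psi ε 𝒱 r.rho r.moment

/-- The covariant `Q`. -/
def OrthogonalRep.covQ [FiniteDimensional k L] {A : QuadraticColourLieAlgebra ε 𝔤}
    (r : OrthogonalRep A.toColourLieAlgebra 𝒱) : MultilinearMap k (fun _ : Fin 4 => V) k :=
  quartic ε 𝒱 r.form r.covPsi

end Covariants

end

end ColourLie

/-!
The identities are proved by passing to a twisted Grassmann envelope, in which they become the
elementary identities satisfied by the covariants of a special symplectic representation.

Fix homogeneous vectors `v i` of degrees `γ i`. In the associative algebra with basis `e_J`, `J` a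
finite set of indices, and relations `e_i ^ 2 = 0`, `e_j e_i = -ε(γ i, γ j) e_i e_j`, the signs and
the factors `ε` produced by moving vectors past each other cancel. Hence among elements
`∑ e_J ⊗ x_J` of total degree `0`, those of odd length with `x_J ∈ V` form a symplectic module,
those of even length with `x_J ∈ 𝔤` form an ordinary Lie algebra with an invariant form, and `μ`
becomes symmetric on odd elements. The value at `(v₁, …, vₙ)` of a sum over shuffles is the
coefficient of `e_{1, …, n}` in the product of the corresponding elements (`hat_wedge`,
`extComp_apply_eq_multiConvo`), because a shuffle is the sorting permutation of a colouring of the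
indices (`sum_shuffles_eq_multiConvo`). All the identities thus concern one generic odd vector
`v = ∑ e_i ⊗ v_i` and the divided powers `μ = μ(v, v) / 2`, `ψ = ψ(v, v, v) / 6`,
`Q = Q(v, v, v, v) / 24`, encoded by `hat` without any division. They satisfy `μ · v = ψ` and
`(v, ψ) = Q`.

For these the classical argument applies.
* Since `{μ, μ} = 0`, equivariance of the moment map gives `0 = {μ, μ(v, v)} = 2 μ(v, ψ)`.
* Speciality says that `μ(x, y) z + (x, z) y + (y, z) x` is symmetric in `x`, `y`, `z`. Comparing
  `(v, v, ψ)` with `(v, ψ, v)` yields `2 μ · ψ = -3 Q v`.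
* Equivariance applied to `0 = {μ, μ(v, ψ)}` gives `μ(ψ, ψ) = -μ(v, μ · ψ) = 3 Q μ`.
* `ψ(ψ, ψ, ψ) = 3 μ(ψ, ψ) ψ = 9 Q (μ · ψ) = -(27 / 2) Q² v`, as `(ψ, ψ) = 0`.
* `Q(ψ, ψ, ψ, ψ) = 4 (ψ, ψ(ψ, ψ, ψ)) = -54 Q² (ψ, v) = 54 Q³`.

That both sides are alternating follows from the behaviour of sums over shuffles under adjacent
transpositions (`isAlt_sum_shuffles`).
-/

namespace ColourLie

set_option linter.unusedSectionVars false

/-! ### Permutations acting on multilinear maps -/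

section PermAct

open Equiv

variable {k Γ V W U T : Type*} [Field k] [AddCommGroup Γ] [DecidableEq Γ]
  [AddCommGroup V] [Module k V] [AddCommGroup W] [Module k W]
  [AddCommGroup U] [Module k U] [AddCommGroup T] [Module k T]

/-- Two multilinear maps which agree on homogeneous vectors are equal. -/
theorem multilinear_ext_homogeneous {n : ℕ} (𝒱 : Γ → Submodule k V) [DirectSum.Decomposition 𝒱]
    {f g : MultilinearMap k (fun _ : Fin n => V) W}
    (h : ∀ (γ : Fin n → Γ) (v : Fin n → V), (∀ i, v i ∈ 𝒱 (γ i)) → f v = g v) : f = g := by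
  classical
  ext v
  have hv : v = fun i => ∑ a ∈ (DirectSum.decompose 𝒱 (v i)).support,
      (DirectSum.decompose 𝒱 (v i) a : V) :=
    funext fun i => (DirectSum.sum_support_decompose 𝒱 (v i)).symm
  rw [hv, f.map_sum_finset, g.map_sum_finset]
  exact Finset.sum_congr rfl fun r _ => h r _ fun i => SetLike.coe_mem _

theorem CommutationFactor.val_mul_swap (ε : CommutationFactor Γ k) (a b : Γ) :
    (ε a b : k) * ε b a = 1 := by
  rw [← Units.val_mul, ε.mul_swap, Units.val_one]

/-- A product over all ordered pairs, regrouped over the unordered pairs. -/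
theorem prod_eq_prod_ordered {ι M R : Type*} [Fintype ι] [CommMonoid M] [LinearOrder R]
    (r : ι → R) (hr : Function.Injective r) (x : ι → ι → M) (hx : ∀ i, x i i = 1) :
    ∏ i, ∏ j, x i j = ∏ i, ∏ j, if r i < r j then x i j * x j i else 1 := by
  have h1 : ∏ i, ∏ j, (if r i < r j then x i j * x j i else 1)
      = (∏ i, ∏ j, if r i < r j then x i j else 1) * ∏ i, ∏ j, if r j < r i then x i j else 1 := by
    rw [Finset.prod_comm (f := fun i j => if r j < r i then x i j else 1)]
    simp only [← Finset.prod_mul_distrib]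
    refine Finset.prod_congr rfl fun i _ => Finset.prod_congr rfl fun j _ => ?_
    split_ifs <;> simp
  rw [h1]
  simp only [← Finset.prod_mul_distrib]
  refine Finset.prod_congr rfl fun i _ => Finset.prod_congr rfl fun j _ => ?_
  rcases lt_trichotomy (r i) (r j) with h | h | h
  · simp [h, h.not_gt]
  · simp [hr h, hx]
  · simp [h, h.not_gt]

/-- The product of `c i j` over the pairs which are ordered one way by `r` and the other way by
`s` is a cocycle: it is multiplicative along a chain of three orderings. -/
theorem prod_inversions_mul {ι M R : Type*} [Fintype ι] [CommMonoid M] [LinearOrder R]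
    (c : ι → ι → M) (hc : ∀ i j, i ≠ j → c i j * c j i = 1) (r s t : ι → R)
    (hr : Function.Injective r) (hs : Function.Injective s) (ht : Function.Injective t) :
    (∏ i, ∏ j, if r i < r j ∧ s j < s i then c i j else 1)
      * (∏ i, ∏ j, if s i < s j ∧ t j < t i then c i j else 1)
      = ∏ i, ∏ j, if r i < r j ∧ t j < t i then c i j else 1 := by
  rw [prod_eq_prod_ordered r hr _ (by simp),
    prod_eq_prod_ordered r hr (fun i j => if s i < s j ∧ t j < t i then c i j else 1) (by simp),
    prod_eq_prod_ordered r hr (fun i j => if r i < r j ∧ t j < t i then c i j else 1) (by simp)]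
  simp only [← Finset.prod_mul_distrib]
  refine Finset.prod_congr rfl fun i _ => Finset.prod_congr rfl fun j _ => ?_
  by_cases h : r i < r j
  · have hij : i ≠ j := fun e => by simp [e] at h
    rcases lt_or_gt_of_ne (hs.ne hij) with h1 | h1 <;>
      rcases lt_or_gt_of_ne (ht.ne hij) with h2 | h2 <;>
      simp [h, h1, h2, h.not_gt, h1.not_gt, h2.not_gt, hc i j hij]
  · simp [h]

/-- The multiplier of `σ` is the product of `-ε(vᵢ, vⱼ)` over the inversions of `σ⁻¹`. -/
theorem multiplier_eq_prod {n : ℕ} (ε : CommutationFactor Γ k) (σ : Perm (Fin n)) (γ : Fin n → Γ) :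
    multiplier ε σ γ
      = ∏ i, ∏ j, if i < j ∧ σ⁻¹ j < σ⁻¹ i then -(ε (γ i) (γ j) : k) else 1 := by
  have hs : ((Perm.sign σ : ℤ) : k) = ∏ i, ∏ j, if i < j ∧ σ⁻¹ j < σ⁻¹ i then (-1 : k) else 1 := by
    rw [← Perm.sign_inv, Perm.sign_eq_prod_prod_Iio, Finset.prod_comm]
    push_cast
    refine Finset.prod_congr rfl fun j _ => ?_
    rw [← Finset.prod_filter_mul_prod_filter_not Finset.univ (fun i => i < j)]
    rw [Finset.prod_eq_one (s := Finset.univ.filter (fun i => ¬ i < j))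
      (fun i hi => by simp at hi; simp [hi.not_gt]), mul_one]
    have : Finset.univ.filter (fun i => i < j) = Finset.Iio j := by ext; simp
    rw [this]
    refine Finset.prod_congr rfl fun i hi => ?_
    have hij : i < j := by simpa using hi
    rcases lt_or_gt_of_ne ((σ⁻¹).injective.ne hij.ne) with h | h
    · rw [if_pos h, if_neg fun h' => h'.2.not_gt h]; simp
    · rw [if_neg h.not_gt, if_pos ⟨hij, h⟩]; simp
  rw [multiplier, hs, Finset.prod_filter, Fintype.prod_prod_type]
  simp only [← Finset.prod_mul_distrib]
  refine Finset.prod_congr rfl fun i _ => Finset.prod_congr rfl fun j _ => ?_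
  split_ifs <;> simp

theorem multiplier_mul {n : ℕ} (ε : CommutationFactor Γ k) (σ τ : Perm (Fin n)) (γ : Fin n → Γ) :
    multiplier ε (σ * τ) γ = multiplier ε σ γ * multiplier ε τ (fun i => γ (σ i)) := by
  have h := prod_inversions_mul (M := k) (fun i j => -(ε (γ i) (γ j) : k))
    (fun i j _ => by rw [neg_mul_neg, ε.val_mul_swap]) id (σ⁻¹ : Perm (Fin n))
    ((σ * τ)⁻¹ : Perm (Fin n)) Function.injective_id (Equiv.injective _) (Equiv.injective _)
  simp only [id] at h
  rw [multiplier_eq_prod, multiplier_eq_prod, multiplier_eq_prod, ← h]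
  congr 1
  rw [← Equiv.prod_comp σ]
  refine Finset.prod_congr rfl fun i _ => ?_
  rw [← Equiv.prod_comp σ]
  simp [mul_inv_rev]

/-- `permAct` is an action of the symmetric group. -/
theorem permAct_mul {n : ℕ} (ε : CommutationFactor Γ k) (𝒱 : Γ → Submodule k V)
    [DirectSum.Decomposition 𝒱] (σ τ : Perm (Fin n))
    (f : MultilinearMap k (fun _ : Fin n => V) W) :
    permAct ε 𝒱 (σ * τ) f = permAct ε 𝒱 σ (permAct ε 𝒱 τ f) := by
  refine multilinear_ext_homogeneous 𝒱 fun γ v hv => ?_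
  rw [permAct_apply ε 𝒱 _ _ γ v hv, permAct_apply ε 𝒱 _ _ γ v hv,
    permAct_apply ε 𝒱 _ _ (fun i => γ (σ i)) _ (fun i => hv (σ i)), multiplier_mul, mul_smul]
  rfl

theorem permAct_one {n : ℕ} (ε : CommutationFactor Γ k) (𝒱 : Γ → Submodule k V)
    [DirectSum.Decomposition 𝒱] (f : MultilinearMap k (fun _ : Fin n => V) W) :
    permAct ε 𝒱 1 f = f := by
  refine multilinear_ext_homogeneous 𝒱 fun γ v hv => ?_
  rw [permAct_apply ε 𝒱 _ _ γ v hv, multiplier_eq_prod, Finset.prod_eq_one, one_smul]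
  · rfl
  · refine fun i _ => Finset.prod_eq_one fun j _ => if_neg ?_
    rintro ⟨h1, h2⟩
    exact absurd h1 (not_lt.2 (le_of_lt (by simpa using h2)))

theorem multiplier_swap {n : ℕ} (ε : CommutationFactor Γ k) (x y : Fin n)
    (hxy : (y : ℕ) = x + 1) (γ : Fin n → Γ) :
    multiplier ε (swap x y) γ = -(ε (γ x) (γ y) : k) := by
  have hlt : x < y := Fin.lt_def.2 (by omega)
  rw [multiplier_eq_prod, Finset.prod_eq_single x, Finset.prod_eq_single y]
  · simp [hlt]
  · intro j _ hj
    refine if_neg ?_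
    rintro ⟨h1, h2⟩
    have hjx : j ≠ x := h1.ne'
    rw [swap_inv, swap_apply_left, swap_apply_of_ne_of_ne hjx hj] at h2
    rw [Fin.lt_def] at h1 h2
    omega
  · simp
  · intro i _ hi
    refine Finset.prod_eq_one fun j _ => if_neg ?_
    rintro ⟨h1, h2⟩
    rw [swap_inv] at h2
    by_cases hiy : i = y
    · subst hiy
      have hjy : j ≠ i := h1.ne'
      have hjx : j ≠ x := (hlt.trans h1).ne'
      rw [swap_apply_right, swap_apply_of_ne_of_ne hjx hjy] at h2
      exact absurd (hlt.trans h1) h2.not_gt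
    · rw [swap_apply_of_ne_of_ne hi hiy] at h2
      by_cases hjx : j = x
      · subst hjx
        rw [swap_apply_left] at h2
        exact absurd (h1.trans hlt) h2.not_gt
      by_cases hjy : j = y
      · subst hjy
        rw [swap_apply_right] at h2
        rw [Fin.lt_def] at h1 h2
        omega
      rw [swap_apply_of_ne_of_ne hjx hjy] at h2
      exact absurd h1 h2.not_gt
  · simp

/-- A multilinear map is alternating as soon as it is fixed by the transpositions of adjacent
variables. -/
theorem isAlt_of_adjacent {n : ℕ} {ε : CommutationFactor Γ k} {𝒱 : Γ → Submodule k V}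
    [DirectSum.Decomposition 𝒱] {f : MultilinearMap k (fun _ : Fin n => V) W}
    (h : ∀ x y : Fin n, (y : ℕ) = x + 1 → permAct ε 𝒱 (swap x y) f = f) : IsAlt ε 𝒱 f := by
  intro σ
  cases n with
  | zero => rw [Subsingleton.elim σ 1, permAct_one]
  | succ n =>
    have hσ : σ ∈ Submonoid.closure (Set.range fun i : Fin n => swap i.castSucc i.succ) := by
      rw [Perm.mclosure_swap_castSucc_succ]; trivial
    induction hσ using Submonoid.closure_induction with
    | mem _ hx =>
      obtain ⟨i, rfl⟩ := hx
      exact h _ _ (by simp)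
    | one => exact permAct_one ..
    | mul a b _ _ ha hb => rw [permAct_mul, hb, ha]

theorem isAlt_of_homogeneous {n : ℕ} {ε : CommutationFactor Γ k} {𝒱 : Γ → Submodule k V}
    [DirectSum.Decomposition 𝒱] {f : MultilinearMap k (fun _ : Fin n => V) W}
    (h : ∀ x y : Fin n, (y : ℕ) = x + 1 → ∀ (γ : Fin n → Γ) (v : Fin n → V),
      (∀ i, v i ∈ 𝒱 (γ i)) → f v = -((ε (γ x) (γ y) : k) • f (fun i => v (swap x y i)))) :
    IsAlt ε 𝒱 f := by
  refine isAlt_of_adjacent fun x y hxy => multilinear_ext_homogeneous 𝒱 fun γ v hv => ?_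
  rw [permAct_apply ε 𝒱 _ _ γ v hv, multiplier_swap ε x y hxy, h x y hxy γ v hv, neg_smul]

theorem IsAlt.apply_swap {n : ℕ} {ε : CommutationFactor Γ k} {𝒱 : Γ → Submodule k V}
    [DirectSum.Decomposition 𝒱] {f : MultilinearMap k (fun _ : Fin n => V) W}
    (h : IsAlt ε 𝒱 f) (x y : Fin n) (hxy : (y : ℕ) = x + 1) (γ : Fin n → Γ) (v : Fin n → V)
    (hv : ∀ i, v i ∈ 𝒱 (γ i)) : f v = -((ε (γ x) (γ y) : k) • f (fun i => v (swap x y i))) := by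
  conv_lhs => rw [← h (swap x y)]
  rw [permAct_apply ε 𝒱 _ _ γ v hv, multiplier_swap ε x y hxy, neg_smul]

theorem isAlt_of_le_one {n : ℕ} (hn : n ≤ 1) (ε : CommutationFactor Γ k) (𝒱 : Γ → Submodule k V)
    [DirectSum.Decomposition 𝒱] (f : MultilinearMap k (fun _ : Fin n => V) W) : IsAlt ε 𝒱 f :=
  isAlt_of_adjacent fun x y hxy => by omega

theorem permAct_sum {n : ℕ} {ι : Type*} (ε : CommutationFactor Γ k) (𝒱 : Γ → Submodule k V)
    [DirectSum.Decomposition 𝒱] (σ : Perm (Fin n)) (s : Finset ι)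
    (f : ι → MultilinearMap k (fun _ : Fin n => V) W) :
    permAct ε 𝒱 σ (∑ i ∈ s, f i) = ∑ i ∈ s, permAct ε 𝒱 σ (f i) := by
  refine multilinear_ext_homogeneous 𝒱 fun γ v hv => ?_
  rw [permAct_apply ε 𝒱 _ _ γ v hv, sum_apply, sum_apply, Finset.smul_sum]
  exact Finset.sum_congr rfl fun i _ => (permAct_apply ε 𝒱 _ _ γ v hv).symm

/-- The sum over the shuffles of a multilinear map which is alternating inside each block is
alternating: multiplication by an adjacent transposition `s` on the left permutes the shuffles,
except for those `σ` for which `s * σ = σ * t` with `t` an adjacent transposition of a block. -/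
theorem isAlt_sum_shuffles {n : ℕ} {ε : CommutationFactor Γ k} {𝒱 : Γ → Submodule k V}
    [DirectSum.Decomposition 𝒱] (b : Fin n → ℕ) (hb : Monotone b)
    {F : MultilinearMap k (fun _ : Fin n => V) W}
    (hF : ∀ x y : Fin n, (y : ℕ) = x + 1 → b x = b y → permAct ε 𝒱 (swap x y) F = F) :
    IsAlt ε 𝒱 (∑ σ ∈ shuffles b, permAct ε 𝒱 σ F) := by
  refine isAlt_of_adjacent fun x y hxy => ?_
  have hlt : x < y := Fin.lt_def.2 (by omega)
  rw [permAct_sum]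
  have key : ∀ σ ∈ shuffles b, b (σ⁻¹ x) ≠ b (σ⁻¹ y) → swap x y * σ ∈ shuffles b := by
    intro σ hσ hne
    simp only [shuffles, Finset.mem_filter, Finset.mem_univ, true_and] at hσ ⊢
    intro p q hpq hlt'
    have h1 := hσ p q hpq hlt'
    have hne' : ¬ (σ p = x ∧ σ q = y) := by
      rintro ⟨rfl, rfl⟩
      simp [hpq] at hne
    rw [Perm.mul_apply, Perm.mul_apply]
    simp only [swap_apply_def]
    rw [Fin.lt_def] at h1 ⊢
    simp only [Fin.ext_iff] at hne'
    split_ifs with h2 h3 h3 h3 h4 h4 <;> simp only [Fin.ext_iff] at * <;> omega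
  have key' : ∀ σ ∈ shuffles b, b (σ⁻¹ x) = b (σ⁻¹ y) →
      swap x y * σ ∉ shuffles b ∧ permAct ε 𝒱 (swap x y * σ) F = permAct ε 𝒱 σ F := by
    intro σ hσ he
    simp only [shuffles, Finset.mem_filter, Finset.mem_univ, true_and] at hσ ⊢
    have hinv : ∀ z, σ (σ⁻¹ z) = z := σ.apply_symm_apply
    have hxy' : σ⁻¹ x < σ⁻¹ y := by
      rcases lt_trichotomy (σ⁻¹ x) (σ⁻¹ y) with h | h | h
      · exact h
      · exact absurd ((σ⁻¹).injective h) hlt.ne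
      · have := hσ _ _ he.symm h
        simp at this
        exact absurd hlt this.not_gt
    refine ⟨fun h => ?_, ?_⟩
    · have := h _ _ he hxy'
      simp at this
      exact absurd hlt this.not_gt
    · have hsucc : ((σ⁻¹ y : Fin n) : ℕ) = (σ⁻¹ x : Fin n) + 1 := by
        by_contra hcon
        have hlt2 : ((σ⁻¹ x : Fin n) : ℕ) + 1 < (σ⁻¹ y : Fin n) := by
          have := Fin.lt_def.1 hxy'; omega
        -- a position strictly between the two would be sent strictly between `x` and `x + 1`
        let z : Fin n := ⟨(σ⁻¹ x : Fin n) + 1, hlt2.trans (σ⁻¹ y).isLt⟩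
        have hz1 : σ⁻¹ x < z := Fin.lt_def.2 (by simp [z])
        have hz2 : z < σ⁻¹ y := Fin.lt_def.2 (by simpa [z] using hlt2)
        have hbz : b (σ⁻¹ x) = b z := le_antisymm (hb hz1.le) (he ▸ hb hz2.le)
        have h1 := hσ _ _ hbz hz1
        have h2 := hσ _ _ (hbz.symm.trans he) hz2
        rw [hinv, Fin.lt_def] at h1 h2
        omega
      have : swap x y * σ = σ * swap (σ⁻¹ x) (σ⁻¹ y) := by
        rw [Equiv.mul_swap_eq_swap_mul, hinv, hinv]
      rw [this, permAct_mul, hF _ _ hsucc he]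
  -- left multiplication by the transposition, restricted to the shuffles it preserves
  have invol : ∀ σ : Perm (Fin n), (fun σ : Perm (Fin n) =>
      if b (σ⁻¹ x) = b (σ⁻¹ y) then σ else swap x y * σ)
      (if b (σ⁻¹ x) = b (σ⁻¹ y) then σ else swap x y * σ) = σ := by
    intro σ
    by_cases h : b (σ⁻¹ x) = b (σ⁻¹ y)
    · simp only [if_pos h]
    · have h' : ¬ b ((swap x y * σ)⁻¹ x) = b ((swap x y * σ)⁻¹ y) := by
        rw [mul_inv_rev, swap_inv, Perm.mul_apply, Perm.mul_apply, swap_apply_left,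
          swap_apply_right]
        exact Ne.symm h
      simp only [if_neg h, if_neg h', swap_mul_self_mul]
  refine Finset.sum_nbij' (fun σ => if b (σ⁻¹ x) = b (σ⁻¹ y) then σ else swap x y * σ)
    (fun σ => if b (σ⁻¹ x) = b (σ⁻¹ y) then σ else swap x y * σ) ?_ ?_ ?_ ?_ ?_
  · intro σ hσ
    split_ifs with h
    exacts [hσ, key σ hσ h]
  · intro σ hσ
    split_ifs with h
    exacts [hσ, key σ hσ h]
  · exact fun σ _ => invol σ
  · exact fun σ _ => invol σ
  · intro σ hσ
    rw [← permAct_mul]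
    split_ifs with h
    exacts [(key' σ hσ h).2, rfl]

theorem IsAlt.wedge {i j : ℕ} {ε : CommutationFactor Γ k} {𝒱 : Γ → Submodule k V}
    [DirectSum.Decomposition 𝒱] (φ : U →ₗ[k] W →ₗ[k] T)
    {f : MultilinearMap k (fun _ : Fin i => V) U} {g : MultilinearMap k (fun _ : Fin j => V) W}
    (hf : IsAlt ε 𝒱 f) (hg : IsAlt ε 𝒱 g) : IsAlt ε 𝒱 (wedge ε 𝒱 φ f g) := by
  refine isAlt_sum_shuffles _ ?_ fun x y hxy hb => ?_
  · intro x y hxy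
    have := Fin.le_def.1 hxy
    dsimp only
    split_ifs <;> omega
  · refine multilinear_ext_homogeneous 𝒱 fun γ v hv => ?_
    rw [permAct_apply ε 𝒱 _ _ γ v hv, multiplier_swap ε x y hxy, prodMap_apply, prodMap_apply]
    by_cases hx : (x : ℕ) < i
    · have hy : (y : ℕ) < i := by
        by_contra hy
        simp [hx, hy] at hb
      obtain ⟨x, rfl⟩ : ∃ x' : Fin i, x = Fin.castAdd j x' := ⟨⟨x, hx⟩, rfl⟩
      obtain ⟨y, rfl⟩ : ∃ y' : Fin i, y = Fin.castAdd j y' := ⟨⟨y, hy⟩, rfl⟩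
      have e1 : ∀ a, swap (Fin.castAdd j x) (Fin.castAdd j y) (Fin.castAdd j a)
          = Fin.castAdd j (swap x y a) :=
        fun a => ((Fin.castAdd_injective i j).map_swap x y a).symm
      have e2 : ∀ a, swap (Fin.castAdd j x) (Fin.castAdd j y) (Fin.natAdd i a) = Fin.natAdd i a :=
        fun a => swap_apply_of_ne_of_ne (by simp [Fin.ext_iff]; omega)
          (by simp [Fin.ext_iff]; omega)
      simp only [e1, e2]
      rw [hf.apply_swap x y hxy (fun a => γ (Fin.castAdd j a)) (fun a => v (Fin.castAdd j a))
        (fun a => hv _)]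
      simp
    · have hy : ¬ (y : ℕ) < i := by omega
      obtain ⟨x, rfl⟩ : ∃ x' : Fin j, x = Fin.natAdd i x' :=
        ⟨⟨x - i, by omega⟩, by ext; simp; omega⟩
      obtain ⟨y, rfl⟩ : ∃ y' : Fin j, y = Fin.natAdd i y' :=
        ⟨⟨y - i, by omega⟩, by ext; simp; omega⟩
      have e1 : ∀ a, swap (Fin.natAdd i x) (Fin.natAdd i y) (Fin.natAdd i a)
          = Fin.natAdd i (swap x y a) :=
        fun a => ((Fin.natAdd_injective j i).map_swap x y a).symm
      have e2 : ∀ a, swap (Fin.natAdd i x) (Fin.natAdd i y) (Fin.castAdd j a) = Fin.castAdd j a :=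
        fun a => swap_apply_of_ne_of_ne (by simp [Fin.ext_iff]; omega)
          (by simp [Fin.ext_iff]; omega)
      simp only [e1, e2]
      rw [hg.apply_swap x y (by simpa [add_assoc] using hxy) (fun a => γ (Fin.natAdd i a))
        (fun a => v (Fin.natAdd i a)) (fun a => hv _)]
      simp

theorem IsAlt.extComp {i j : ℕ} {ε : CommutationFactor Γ k} {𝒱 : Γ → Submodule k V}
    [DirectSum.Decomposition 𝒱] (f : MultilinearMap k (fun _ : Fin i => W) U)
    {g : MultilinearMap k (fun _ : Fin j => V) W} (hg : IsAlt ε 𝒱 g) :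
    IsAlt ε 𝒱 (extComp ε 𝒱 f g) := by
  refine isAlt_sum_shuffles _ (fun x y hxy => Nat.div_le_div_right hxy) fun x y hxy hb => ?_
  refine multilinear_ext_homogeneous 𝒱 fun γ v hv => ?_
  rw [permAct_apply ε 𝒱 _ _ γ v hv, multiplier_swap ε x y hxy, compMap_apply, compMap_apply]
  obtain ⟨⟨r, s⟩, rfl⟩ := finProdFinEquiv.surjective x
  obtain ⟨⟨r', t⟩, rfl⟩ := finProdFinEquiv.surjective y
  have hj : 0 < j := s.pos
  -- equality of the quotients by `j` means that `x` and `y` lie in the same block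
  have hr : r = r' := by
    have h1 : ((s : ℕ) + j * r) / j = r := by
      rw [Nat.add_mul_div_left _ _ hj, Nat.div_eq_of_lt s.isLt, zero_add]
    have h2 : ((t : ℕ) + j * r') / j = r' := by
      rw [Nat.add_mul_div_left _ _ hj, Nat.div_eq_of_lt t.isLt, zero_add]
    simp only [finProdFinEquiv_apply_val] at hb
    rw [h1, h2] at hb
    exact Fin.ext hb
  subst hr
  have hst : (t : ℕ) = s + 1 := by
    simp only [finProdFinEquiv_apply_val] at hxy
    omega
  have e : ∀ r' a, swap (finProdFinEquiv (r, s)) (finProdFinEquiv (r, t)) (finProdFinEquiv (r', a))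
      = finProdFinEquiv (r', if r' = r then swap s t a else a) := by
    intro r' a
    rw [← finProdFinEquiv.injective.map_swap]
    congr 1
    simp only [swap_apply_def, Prod.mk.injEq]
    split_ifs <;> simp_all
  have e2 : (fun r' => g (fun a => v (swap (finProdFinEquiv (r, s)) (finProdFinEquiv (r, t))
      (finProdFinEquiv (r', a)))))
      = Function.update (fun r' => g (fun a => v (finProdFinEquiv (r', a)))) r
        (g (fun a => v (finProdFinEquiv (r, swap s t a)))) := by
    funext r'
    by_cases h : r' = r
    · subst h; simp [e]
    · simp [e, h]
  rw [e2, ← f.map_update_smul, neg_smul, ← hg.apply_swap s t hst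
    (fun a => γ (finProdFinEquiv (r, a))) (fun a => v (finProdFinEquiv (r, a))) (fun a => hv _)]
  congr 1
  exact Function.update_eq_self r _

end PermAct

/-! ### The twisted exterior envelope -/

section Envelope

noncomputable section

open Finset

variable {k Γ V W U T ι : Type*} [Field k] [AddCommGroup Γ] [DecidableEq Γ]
  [AddCommGroup V] [Module k V] [AddCommGroup W] [Module k W]
  [AddCommGroup U] [Module k U] [AddCommGroup T] [Module k T] [Fintype ι] [LinearOrder ι]

/-- The structure constants of the twisted exterior algebra on generators `e_i`, `i : ι`, where
`e_i` is attached to the degree `γ i`: for finite sets `J`, `K` of indices,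
`e_J e_K = cross J K • e_{J ∪ K}`. The relations are `e_i ^ 2 = 0` and
`e_j e_l = -ε(γ l, γ j) e_l e_j`. -/
def cross (ε : CommutationFactor Γ k) (γ : ι → Γ) (J K : Finset ι) : k :=
  if Disjoint J K then ∏ j ∈ J, ∏ l ∈ K, (if l < j then -(ε (γ l) (γ j) : k) else 1) else 0

/-- An element `∑ e_J ⊗ x_J` of the twisted exterior algebra with coefficients in `W` is encoded by
its coefficients. `convo F` is `∑ e_J e_K ⊗ F J K`; when `F J K = φ (x J) (y K)` it is the extension
of the bilinear map `φ` evaluated at `x` and `y`. -/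
def convo (ε : CommutationFactor Γ k) (γ : ι → Γ) (F : Finset ι → Finset ι → W)
    (I : Finset ι) : W :=
  ∑ J, ∑ K, if J ∪ K = I then cross ε γ J K • F J K else 0

variable (ε : CommutationFactor Γ k) (γ : ι → Γ)

theorem cross_eq_zero {J K : Finset ι} (h : ¬ Disjoint J K) : cross ε γ J K = 0 := if_neg h

theorem cross_union_left {J K : Finset ι} (h : Disjoint J K) (L : Finset ι) :
    cross ε γ (J ∪ K) L = cross ε γ J L * cross ε γ K L := by
  simp only [cross, disjoint_union_left]
  by_cases h1 : Disjoint J L <;> by_cases h2 : Disjoint K L <;> simp [h1, h2, prod_union h]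

theorem cross_biUnion_right {m : ℕ} (J : Finset ι) (𝒥 : Fin m → Finset ι)
    (h : ∀ r s, r ≠ s → Disjoint (𝒥 r) (𝒥 s)) :
    cross ε γ J (univ.biUnion 𝒥) = ∏ r, cross ε γ J (𝒥 r) := by
  by_cases hd : ∀ r, Disjoint J (𝒥 r)
  · have h1 : Disjoint J (univ.biUnion 𝒥) := by simpa [disjoint_biUnion_right] using hd
    simp only [cross, h1, hd, if_true]
    refine Eq.trans (prod_congr rfl fun j _ => ?_) prod_comm
    exact prod_biUnion fun r _ s _ hrs => h r s hrs
  · have h1 : ¬ Disjoint J (univ.biUnion 𝒥) := by simpa [disjoint_biUnion_right] using hd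
    obtain ⟨r, hr⟩ := not_forall.1 hd
    rw [cross_eq_zero ε γ h1, prod_eq_zero (mem_univ r) (cross_eq_zero ε γ hr)]

theorem cross_union_right {K L : Finset ι} (h : Disjoint K L) (J : Finset ι) :
    cross ε γ J (K ∪ L) = cross ε γ J K * cross ε γ J L := by
  simp only [cross, disjoint_union_right]
  by_cases h1 : Disjoint J K <;> by_cases h2 : Disjoint J L <;>
    simp [h1, h2, prod_union h, prod_mul_distrib]

/-- The factor relating `e_J e_K` and `e_K e_J`. -/
def swapFactor (J K : Finset ι) : k :=
  (-1) ^ (J.card * K.card) * (ε (∑ i ∈ J, γ i) (∑ i ∈ K, γ i) : k)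

theorem CommutationFactor.zero_left (a : Γ) : ε 0 a = 1 := by
  have h := ε.map_add_left 0 0 a
  rw [add_zero] at h
  exact left_eq_mul.mp h

theorem CommutationFactor.zero_right (a : Γ) : ε a 0 = 1 := by
  have h := ε.map_add_right a 0 0
  rw [add_zero] at h
  exact left_eq_mul.mp h

theorem CommutationFactor.map_sum_left (J : Finset ι) (a : Γ) :
    ε (∑ i ∈ J, γ i) a = ∏ i ∈ J, ε (γ i) a := by
  induction J using Finset.induction_on with
  | empty => simp [ε.zero_left]
  | insert i s hi ih => rw [sum_insert hi, prod_insert hi, ε.map_add_left, ih]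

theorem CommutationFactor.map_sum_right (J : Finset ι) (a : Γ) :
    ε a (∑ i ∈ J, γ i) = ∏ i ∈ J, ε a (γ i) := by
  induction J using Finset.induction_on with
  | empty => simp [ε.zero_right]
  | insert i s hi ih => rw [sum_insert hi, prod_insert hi, ε.map_add_right, ih]

/-- The product is commutative up to `swapFactor`. -/
theorem cross_comm (J K : Finset ι) :
    cross ε γ K J = swapFactor ε γ J K * cross ε γ J K := by
  by_cases h : Disjoint J K
  · have hs : swapFactor ε γ J K = ∏ j ∈ J, ∏ l ∈ K, -(ε (γ j) (γ l) : k) := by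
      have : ∏ j ∈ J, ∏ l ∈ K, -(ε (γ j) (γ l) : k)
          = ∏ j ∈ J, ∏ l ∈ K, (-1 : k) * (ε (γ j) (γ l) : k) := by simp
      rw [this, swapFactor, ε.map_sum_left]
      simp only [ε.map_sum_right, prod_mul_distrib, prod_const, Units.coe_prod]
      rw [← pow_mul, mul_comm K.card]
    rw [cross, cross, if_pos h, if_pos h.symm, hs, prod_comm, ← prod_mul_distrib]
    refine prod_congr rfl fun j hj => ?_
    rw [← prod_mul_distrib]
    refine prod_congr rfl fun l hl => ?_
    have hjl : j ≠ l := fun e => (Finset.disjoint_left.1 h hj) (e ▸ hl)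
    rcases lt_or_gt_of_ne hjl with h1 | h1
    · simp [h1, h1.not_gt]
    · simp [h1, h1.not_gt, ε.val_mul_swap]
  · rw [cross_eq_zero ε γ h, cross_eq_zero ε γ (fun h' => h h'.symm), mul_zero]

variable {ε γ}

theorem convo_congr {F G : Finset ι → Finset ι → W}
    (h : ∀ J K, Disjoint J K → F J K = G J K) : convo ε γ F = convo ε γ G := by
  funext I
  refine sum_congr rfl fun J _ => sum_congr rfl fun K _ => ?_
  by_cases hd : Disjoint J K
  · rw [h J K hd]
  · simp [cross_eq_zero ε γ hd]

theorem map_convo (φ : W →ₗ[k] T) (F : Finset ι → Finset ι → W) (I : Finset ι) :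
    φ (convo ε γ F I) = convo ε γ (fun J K => φ (F J K)) I := by
  simp only [convo, map_sum]
  refine sum_congr rfl fun J _ => sum_congr rfl fun K _ => ?_
  split_ifs <;> simp

theorem convo_add (F G : Finset ι → Finset ι → W) :
    convo ε γ (fun J K => F J K + G J K) = convo ε γ F + convo ε γ G := by
  funext I
  simp only [convo, Pi.add_apply, ← sum_add_distrib]
  refine sum_congr rfl fun J _ => sum_congr rfl fun K _ => ?_
  split_ifs <;> simp

theorem convo_smul (c : k) (F : Finset ι → Finset ι → W) :
    convo ε γ (fun J K => c • F J K) = c • convo ε γ F :=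
  funext fun I => (map_convo (LinearMap.lsmul k W c) F I).symm

theorem convo_neg (F : Finset ι → Finset ι → W) :
    convo ε γ (fun J K => -F J K) = -convo ε γ F :=
  funext fun I => (map_convo (-LinearMap.id : W →ₗ[k] W) F I).symm

/-- Associativity of the twisted exterior algebra. -/
theorem convo_assoc (F : Finset ι → Finset ι → Finset ι → W) :
    convo ε γ (fun M L => convo ε γ (fun J K => F J K L) M)
      = convo ε γ (fun J M => convo ε γ (fun K L => F J K L) M) := by
  funext I
  have e1 : convo ε γ (fun M L => convo ε γ (fun J K => F J K L) M) I
      = ∑ M, ∑ L, ∑ J, ∑ K, if J ∪ K = M then (if M ∪ L = I then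
        (cross ε γ J K * cross ε γ M L) • F J K L else 0) else 0 := by
    simp only [convo]
    refine sum_congr rfl fun M _ => sum_congr rfl fun L _ => ?_
    split_ifs with h
    · simp only [smul_sum]
      refine sum_congr rfl fun J _ => sum_congr rfl fun K _ => ?_
      split_ifs
      · rw [smul_smul, mul_comm]
      · rw [smul_zero]
    · simp only [ite_self, sum_const_zero]
  have e2 : convo ε γ (fun J M => convo ε γ (fun K L => F J K L) M) I
      = ∑ J, ∑ M, ∑ K, ∑ L, if K ∪ L = M then (if J ∪ M = I then
        (cross ε γ J M * cross ε γ K L) • F J K L else 0) else 0 := by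
    simp only [convo]
    refine sum_congr rfl fun J _ => sum_congr rfl fun M _ => ?_
    split_ifs with h
    · simp only [smul_sum]
      refine sum_congr rfl fun K _ => sum_congr rfl fun L _ => ?_
      split_ifs
      · rw [smul_smul]
      · rw [smul_zero]
    · simp only [ite_self, sum_const_zero]
  rw [e1, e2]
  -- both sides become sums over `J`, `K`, `L` once the union `M` of two of them is summed last
  refine ((sum_congr rfl fun M _ => sum_comm).trans (sum_comm.trans (sum_congr rfl fun J _ =>
    (sum_congr rfl fun M _ => sum_comm).trans (sum_comm.trans
      (sum_congr rfl fun K _ => sum_comm))))).trans ?_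
  refine sum_congr rfl fun J _ => ?_
  refine Eq.symm ((sum_comm.trans (sum_congr rfl fun K _ => sum_comm)).trans ?_)
  refine sum_congr rfl fun K _ => sum_congr rfl fun L _ => ?_
  rw [sum_ite_eq, sum_ite_eq, if_pos (mem_univ _), if_pos (mem_univ _), union_assoc]
  split_ifs
  · by_cases hJK : Disjoint J K
    · by_cases hKL : Disjoint K L
      · rw [cross_union_left ε γ hJK, cross_union_right ε γ hKL]
        congr 1; ring
      · simp [cross_union_left ε γ hJK, cross_eq_zero ε γ hKL]
    · by_cases hKL : Disjoint K L
      · simp [cross_union_right ε γ hKL, cross_eq_zero ε γ hJK]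
      · simp [cross_eq_zero ε γ hJK, cross_eq_zero ε γ hKL]
  · rfl

/-- Graded commutativity of the twisted exterior algebra. -/
theorem convo_comm (F : Finset ι → Finset ι → W) :
    convo ε γ F = convo ε γ (fun J K => swapFactor ε γ J K • F K J) := by
  funext I
  rw [convo, sum_comm]
  refine sum_congr rfl fun J _ => sum_congr rfl fun K _ => ?_
  rw [union_comm, smul_smul, cross_comm ε γ J K, mul_comm]

variable (ε γ)

/-- The coefficient of `e_I` in the product `e_{𝒥 0} e_{𝒥 1} ⋯`. It vanishes unless the sets `𝒥 r`
form an ordered partition of `I`, since `cross` vanishes on sets which meet. -/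
def multiCross {m : ℕ} (𝒥 : Fin m → Finset ι) (I : Finset ι) : k :=
  if univ.biUnion 𝒥 = I then ∏ r, ∏ s, if s < r then cross ε γ (𝒥 s) (𝒥 r) else 1 else 0

/-- The analogue of `convo` for products of `m` factors. -/
def multiConvo {m : ℕ} (X : (Fin m → Finset ι) → W) (I : Finset ι) : W :=
  ∑ 𝒥, multiCross ε γ 𝒥 I • X 𝒥

variable {ε γ}

theorem disjoint_of_prod_cross_ne_zero {m : ℕ} {𝒥 : Fin m → Finset ι}
    (h : (∏ r, ∏ s, if s < r then cross ε γ (𝒥 s) (𝒥 r) else 1) ≠ 0) (r s : Fin m)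
    (hrs : r ≠ s) : Disjoint (𝒥 r) (𝒥 s) := by
  wlog hlt : s < r generalizing r s
  · exact (this s r hrs.symm ((not_lt.1 hlt).lt_of_ne hrs)).symm
  by_contra hd
  refine h (prod_eq_zero (mem_univ r) (prod_eq_zero (mem_univ s) ?_))
  rw [if_pos hlt, cross_eq_zero ε γ (fun h' => hd h'.symm)]

/-- A product of `m + 1` factors is the product of the first one with the product of the others. -/
theorem multiConvo_succ {m : ℕ} (X : (Fin (m + 1) → Finset ι) → W) :
    multiConvo ε γ X = convo ε γ (fun J M => multiConvo ε γ (fun 𝒥 => X (Fin.cons J 𝒥)) M) := by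
  funext I
  rw [multiConvo, ← (Fin.consEquiv (fun _ => Finset ι)).sum_comp, Fintype.sum_prod_type, convo]
  refine sum_congr rfl fun J _ => ?_
  have : ∀ M : Finset ι, (if J ∪ M = I then cross ε γ J M •
      multiConvo ε γ (fun 𝒥 : Fin m → Finset ι => X (Fin.cons J 𝒥)) M else 0)
      = ∑ 𝒥 : Fin m → Finset ι, if univ.biUnion 𝒥 = M then (if J ∪ M = I then
        (cross ε γ J M * ∏ r, ∏ s, if s < r then cross ε γ (𝒥 s) (𝒥 r) else 1) •
          X (Fin.cons J 𝒥) else 0) else 0 := by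
    intro M
    split_ifs with h
    · rw [multiConvo, smul_sum]
      refine sum_congr rfl fun 𝒥 _ => ?_
      rw [multiCross]
      split_ifs <;> simp [smul_smul]
    · simp
  simp only [this]
  rw [sum_comm]
  refine sum_congr rfl fun 𝒥 _ => ?_
  rw [sum_ite_eq, if_pos (mem_univ _)]
  have hU : univ.biUnion (Fin.cons J 𝒥 : Fin (m + 1) → Finset ι) = J ∪ univ.biUnion 𝒥 := by
    ext x; simp [Fin.exists_fin_succ]
  have hP : (∏ r, ∏ s, if s < r then cross ε γ ((Fin.cons J 𝒥 : Fin (m + 1) → Finset ι) s)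
      ((Fin.cons J 𝒥 : Fin (m + 1) → Finset ι) r) else 1)
      = cross ε γ J (univ.biUnion 𝒥)
        * ∏ r, ∏ s, if s < r then cross ε γ (𝒥 s) (𝒥 r) else 1 := by
    simp only [Fin.prod_univ_succ, Fin.not_lt_zero, if_false, prod_const_one, one_mul,
      Fin.succ_pos, if_true, Fin.cons_zero, Fin.cons_succ, Fin.succ_lt_succ_iff, prod_mul_distrib]
    by_cases h0 : (∏ r, ∏ s, if s < r then cross ε γ (𝒥 s) (𝒥 r) else 1) = 0
    · rw [h0, mul_zero, mul_zero]
    · rw [cross_biUnion_right ε γ J 𝒥 (disjoint_of_prod_cross_ne_zero h0)]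
  change multiCross ε γ (Fin.cons J 𝒥) I • X (Fin.cons J 𝒥) = _
  rw [multiCross, hU, hP]
  split_ifs <;> simp

theorem multiConvo_one (X : (Fin 1 → Finset ι) → W) (I : Finset ι) :
    multiConvo ε γ X I = X (fun _ => I) := by
  rw [multiConvo, Fintype.sum_eq_single (fun _ => I)]
  · simp [multiCross]
  · intro 𝒥 h𝒥
    rw [multiCross, if_neg, zero_smul]
    intro h
    refine h𝒥 (funext fun i => ?_)
    rw [Subsingleton.elim i 0]
    simpa using h

theorem multiConvo_two (X : (Fin 2 → Finset ι) → W) :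
    multiConvo ε γ X = convo ε γ (fun J K => X ![J, K]) := by
  simp only [multiConvo_succ X, multiConvo_one]
  congr 1; funext J K; congr 1; funext i; fin_cases i <;> rfl

theorem multiConvo_three (X : (Fin 3 → Finset ι) → W) :
    multiConvo ε γ X = convo ε γ (fun J M => convo ε γ (fun K L => X ![J, K, L]) M) := by
  simp only [multiConvo_succ X, multiConvo_two]
  rfl

theorem multiConvo_four (X : (Fin 4 → Finset ι) → W) :
    multiConvo ε γ X = convo ε γ (fun J M =>
      multiConvo ε γ (fun 𝒥 : Fin 3 → Finset ι => X ![J, 𝒥 0, 𝒥 1, 𝒥 2]) M) := by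
  rw [multiConvo_succ X]
  congr 1; funext J M; congr 1; funext 𝒥; congr 1; funext i; fin_cases i <;> rfl

/-- The sum over the shuffles of a monotone colouring `b` is a sum over all ordered partitions
whose blocks have the sizes of the fibres of `b`: a shuffle `σ` is determined by the colouring
`b ∘ σ⁻¹`, being the permutation which sorts it. -/
theorem sum_shuffles_eq_multiConvo {N m : ℕ} {𝒱 : Γ → Submodule k V} [DirectSum.Decomposition 𝒱]
    (b : Fin N → Fin m) (hb : Monotone b) (F : MultilinearMap k (fun _ : Fin N => V) W)
    (v : ι → V) (hv : ∀ i, v i ∈ 𝒱 (γ i)) (e : Fin N ↪o ι) (X : (Fin m → Finset ι) → W)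
    (hX0 : ∀ 𝒥, X 𝒥 ≠ 0 → ∀ r, (𝒥 r).card = (univ.filter (b · = r)).card)
    (hX : ∀ σ ∈ shuffles (fun a => (b a : ℕ)),
      X (fun r => (univ.filter (b · = r)).image (fun a => e (σ a))) = F (fun a => v (e (σ a)))) :
    (∑ σ ∈ shuffles (fun a => (b a : ℕ)), permAct ε 𝒱 σ F) (fun a => v (e a))
      = multiConvo ε γ X (univ.image e) := by
  have hsh : ∀ σ : Equiv.Perm (Fin N), σ ∈ shuffles (fun a => (b a : ℕ)) ↔
      ∀ x y, b x = b y → x < y → σ x < σ y := by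
    intro σ; simp [shuffles, Fin.ext_iff]
  have hmem : ∀ (σ : Equiv.Perm (Fin N)) (r : Fin m) (x : Fin N),
      e x ∈ (univ.filter (b · = r)).image (fun a => e (σ a)) ↔ b (σ⁻¹ x) = r := by
    intro σ r x
    simp only [mem_image, mem_filter, mem_univ, true_and]
    constructor
    · rintro ⟨a, ha, hax⟩
      rw [← e.injective hax]
      simpa using ha
    · intro h
      exact ⟨σ⁻¹ x, h, congrArg e (σ.apply_symm_apply x)⟩
  have hsort : ∀ σ ∈ shuffles (fun a => (b a : ℕ)), σ = Tuple.sort (b ∘ (σ⁻¹ : Equiv.Perm _)) := by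
    intro σ hσ
    have hc : (b ∘ (σ⁻¹ : Equiv.Perm _)) ∘ σ = b := by funext x; simp
    refine Tuple.eq_sort_iff.2 ⟨hc.symm ▸ hb, fun i j hij h => (hsh σ).1 hσ i j ?_ hij⟩
    simpa using h
  rw [_root_.sum_apply, multiConvo]
  refine sum_of_injOn (fun σ r => (univ.filter (b · = r)).image (fun a => e (σ a)))
    ?_ (fun _ _ => mem_coe.2 (mem_univ _)) ?_ ?_
  · intro σ hσ τ hτ h
    rw [hsort σ hσ, hsort τ hτ]
    congr 1
    funext x
    have h1 := (hmem σ (b (σ⁻¹ x)) x).2 rfl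
    have h2 := congrFun h (b (σ⁻¹ x))
    simp only at h2
    rw [h2, hmem] at h1
    exact h1.symm
  · intro 𝒥 _ h𝒥
    by_contra hne
    have hco : multiCross ε γ 𝒥 (univ.image e) ≠ 0 := fun h => hne (by rw [h, zero_smul])
    have hX1 : X 𝒥 ≠ 0 := fun h => hne (by rw [h, smul_zero])
    have hU : univ.biUnion 𝒥 = univ.image e := by
      by_contra h; exact hco (if_neg h)
    rw [multiCross, if_pos hU] at hco
    have hdis := disjoint_of_prod_cross_ne_zero hco
    -- a partition with a non-zero coefficient is given by the fibres of a colouring `c`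
    have hex : ∀ x : Fin N, ∃ r, e x ∈ 𝒥 r := by
      intro x
      have : e x ∈ univ.biUnion 𝒥 := by rw [hU]; simp
      simpa using this
    choose c hc using hex
    have hc' : ∀ x r, e x ∈ 𝒥 r → c x = r := by
      intro x r hr
      by_contra hne'
      exact Finset.disjoint_left.1 (hdis _ _ hne') (hc x) hr
    have hJ : ∀ r, 𝒥 r = (univ.filter (c · = r)).image e := by
      intro r
      ext y
      simp only [mem_image, mem_filter, mem_univ, true_and]
      constructor
      · intro hy
        have : y ∈ univ.image e := by rw [← hU]; exact mem_biUnion.2 ⟨r, mem_univ _, hy⟩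
        obtain ⟨x, _, rfl⟩ := mem_image.1 this
        exact ⟨x, hc' x r hy, rfl⟩
      · rintro ⟨x, rfl, rfl⟩
        exact hc x
    -- the fibres of `c` and `b` have the same sizes, so that `c` sorts to the monotone map `b`
    have hcard : ∀ r, Fintype.card {x // b x = r} = Fintype.card {x // c x = r} := by
      intro r
      rw [Fintype.card_subtype, Fintype.card_subtype, ← hX0 𝒥 hX1 r, hJ r,
        card_image_of_injective _ e.injective]
    let π : Equiv.Perm (Fin N) := Equiv.ofFiberEquiv (f := b) (g := c)
      (fun r => Fintype.equivOfCardEq (hcard r))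
    have hπ : c ∘ π = b := funext fun x => Equiv.ofFiberEquiv_map _ x
    have hs : c ∘ Tuple.sort c = b := by
      rw [← hπ]
      exact Tuple.unique_monotone (Tuple.monotone_sort c) (hπ.symm ▸ hb)
    refine h𝒥 ⟨Tuple.sort c, mem_coe.2 ((hsh _).2 fun x y hxy hlt => ?_), funext fun r => ?_⟩
    · refine (Tuple.eq_sort_iff.1 (rfl : Tuple.sort c = Tuple.sort c)).2 x y hlt ?_
      simpa [← hs] using hxy
    · ext y
      rw [hJ r]
      constructor
      · intro hy
        obtain ⟨a, ha, rfl⟩ := mem_image.1 hy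
        refine mem_image_of_mem e ?_
        simpa [← hs] using ha
      · intro hy
        obtain ⟨a, ha, rfl⟩ := mem_image.1 hy
        rw [hmem, ← hs]
        simpa using ha
  · intro σ hσ
    rw [permAct_apply ε 𝒱 σ F (fun a => γ (e a)) _ (fun a => hv _), hX σ hσ]
    congr 1
    have himg : ∀ r, (univ.filter (b · = r)).image (fun a => e (σ a))
        = (univ.filter (fun x => b (σ⁻¹ x) = r)).image e := by
      intro r
      ext y
      constructor
      · intro hy
        obtain ⟨a, ha, rfl⟩ := mem_image.1 hy
        exact mem_image_of_mem e (by simpa using ha)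
      · intro hy
        obtain ⟨a, ha, rfl⟩ := mem_image.1 hy
        rw [hmem]
        simpa using ha
    have hcross : ∀ r s, s < r → cross ε γ ((univ.filter (b · = s)).image (fun a => e (σ a)))
        ((univ.filter (b · = r)).image (fun a => e (σ a)))
        = ∏ i ∈ univ.filter (fun x => b (σ⁻¹ x) = r), ∏ j ∈ univ.filter (fun x => b (σ⁻¹ x) = s),
          if i < j then -(ε (γ (e i)) (γ (e j)) : k) else 1 := by
      intro r s hrs
      rw [himg, himg, cross, if_pos]
      · rw [prod_image (fun _ _ _ _ h => e.injective h), prod_comm]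
        rw [prod_image (fun _ _ _ _ h => e.injective h)]
        simp
      · rw [disjoint_image e.injective, disjoint_filter]
        intro x _ h1 h2
        exact hrs.ne (h1.symm.trans h2)
    rw [multiplier_eq_prod, multiCross, if_pos]
    · rw [← prod_fiberwise univ (fun x => b (σ⁻¹ x))]
      refine prod_congr rfl fun r _ => ?_
      have : ∀ i, (∏ j, if i < j ∧ σ⁻¹ j < σ⁻¹ i then -(ε (γ (e i)) (γ (e j)) : k) else 1)
          = ∏ s, ∏ j ∈ univ.filter (fun x => b (σ⁻¹ x) = s),
            if i < j ∧ σ⁻¹ j < σ⁻¹ i then -(ε (γ (e i)) (γ (e j)) : k) else 1 :=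
        fun i => (prod_fiberwise univ (fun x => b (σ⁻¹ x)) _).symm
      simp only [this]
      rw [prod_comm]
      refine prod_congr rfl fun s _ => ?_
      split_ifs with hrs
      · rw [hcross r s hrs]
        refine prod_congr rfl fun i hi => prod_congr rfl fun j hj => ?_
        have hi' : b (σ⁻¹ i) = r := (mem_filter.1 hi).2
        have hj' : b (σ⁻¹ j) = s := (mem_filter.1 hj).2
        have : σ⁻¹ j < σ⁻¹ i := by
          by_contra hcon
          exact absurd (hb (not_lt.1 hcon)) (by rw [hi', hj']; exact not_le.2 hrs)
        simp only [this, and_true]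
      · refine prod_eq_one fun i hi => prod_eq_one fun j hj => if_neg ?_
        have hi' : b (σ⁻¹ i) = r := (mem_filter.1 hi).2
        have hj' : b (σ⁻¹ j) = s := (mem_filter.1 hj).2
        rintro ⟨h1, h2⟩
        have hle := hb h2.le
        rw [hi', hj'] at hle
        have heq : s = r := le_antisymm hle (not_lt.1 hrs)
        have := (hsh σ).1 hσ _ _ (by rw [hi', hj', heq]) h2
        rw [show σ (σ⁻¹ j) = j from σ.apply_symm_apply j,
          show σ (σ⁻¹ i) = i from σ.apply_symm_apply i] at this
        exact absurd h1 this.not_gt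
    · ext y
      simp only [mem_biUnion, mem_univ, true_and, mem_image]
      constructor
      · rintro ⟨r, a, _, rfl⟩
        exact ⟨_, rfl⟩
      · rintro ⟨x, rfl⟩
        exact ⟨b (σ⁻¹ x), σ⁻¹ x, by simp, congrArg e (σ.apply_symm_apply x)⟩

/-- The values of a multilinear map `f` at the subfamilies of `v`, listed increasingly. It encodes
the divided power `f(v, …, v) / r!` of `f` at the generic element `v = ∑ e_i ⊗ v i`. -/
def hat {r : ℕ} (f : MultilinearMap k (fun _ : Fin r => V) W) (v : ι → V) (J : Finset ι) : W :=
  if h : J.card = r then f (fun a => v (J.orderEmbOfFin h a)) else 0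

theorem hat_of_card_ne {r : ℕ} (f : MultilinearMap k (fun _ : Fin r => V) W) (v : ι → V)
    {J : Finset ι} (h : J.card ≠ r) : hat f v J = 0 := dif_neg h

/-- Any increasing enumeration of `J` computes `hat f v J`. -/
theorem hat_image {r : ℕ} (f : MultilinearMap k (fun _ : Fin r => V) W) (v : ι → V)
    (u : Fin r → ι) (hu : StrictMono u) {J : Finset ι} (hJ : univ.image u = J) :
    hat f v J = f (fun a => v (u a)) := by
  have hc : J.card = r := by rw [← hJ, card_image_of_injective _ hu.injective]; simp
  rw [hat, dif_pos hc,
    ← orderEmbOfFin_unique hc (fun x => hJ ▸ mem_image_of_mem u (mem_univ x)) hu]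

theorem apply_eq_hat {r : ℕ} (f : MultilinearMap k (fun _ : Fin r => V) W) (v : Fin r → V) :
    f v = hat f v univ := (hat_image f v id strictMono_id (by simp)).symm

theorem hat_smul {r : ℕ} (c : k) (f : MultilinearMap k (fun _ : Fin r => V) W) (v : ι → V) :
    hat (c • f) v = c • hat f v := by
  funext J
  simp only [hat, Pi.smul_apply]
  split_ifs <;> simp

/-- Exterior products of multilinear maps correspond to products in the envelope. -/
theorem hat_wedge {i j : ℕ} {𝒱 : Γ → Submodule k V} [DirectSum.Decomposition 𝒱]
    (φ : U →ₗ[k] W →ₗ[k] T) (f : MultilinearMap k (fun _ : Fin i => V) U)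
    (g : MultilinearMap k (fun _ : Fin j => V) W) (v : ι → V) (hv : ∀ a, v a ∈ 𝒱 (γ a)) :
    hat (wedge ε 𝒱 φ f g) v = convo ε γ (fun J K => φ (hat f v J) (hat g v K)) := by
  funext I
  by_cases hI : I.card = i + j
  · have hb : (fun a : Fin (i + j) => if (a : ℕ) < i then 0 else 1)
        = fun a : Fin (i + j) => (((if (a : ℕ) < i then 0 else 1 : Fin 2) : Fin 2) : ℕ) := by
      funext a; split_ifs <;> rfl
    have h0 : univ.filter (fun a : Fin (i + j) => (if (a : ℕ) < i then 0 else 1 : Fin 2) = 0)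
        = univ.image (Fin.castAdd j) := by
      ext a
      simp only [mem_filter, mem_univ, true_and, mem_image]
      constructor
      · intro h
        exact ⟨⟨a, by by_contra hn; simp [hn] at h⟩, rfl⟩
      · rintro ⟨a, rfl⟩; simp
    have h1 : univ.filter (fun a : Fin (i + j) => (if (a : ℕ) < i then 0 else 1 : Fin 2) = 1)
        = univ.image (Fin.natAdd i) := by
      ext a
      simp only [mem_filter, mem_univ, true_and, mem_image]
      constructor
      · intro h
        have : ¬ (a : ℕ) < i := by intro hn; simp [hn] at h
        exact ⟨⟨a - i, by omega⟩, by ext; simp; omega⟩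
      · rintro ⟨a, rfl⟩; simp
    rw [hat, dif_pos hI, wedge, hb,
      sum_shuffles_eq_multiConvo (γ := γ)
        (fun a : Fin (i + j) => (if (a : ℕ) < i then 0 else 1 : Fin 2)) ?_ _ v hv _
        (fun 𝒥 => φ (hat f v (𝒥 0)) (hat g v (𝒥 1))) ?_ ?_, multiConvo_two]
    · have : univ.image (I.orderEmbOfFin hI) = I := by simp
      rw [this]
      rfl
    · intro a c hac
      have := Fin.le_def.1 hac
      dsimp only
      split_ifs <;> omega
    · intro 𝒥 h𝒥 r
      have hf : (𝒥 0).card = i := by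
        by_contra h; exact h𝒥 (by rw [hat_of_card_ne f v h]; simp)
      have hg : (𝒥 1).card = j := by
        by_contra h; exact h𝒥 (by rw [hat_of_card_ne g v h]; simp)
      fin_cases r
      · change (𝒥 0).card = (univ.filter
          (fun a : Fin (i + j) => (if (a : ℕ) < i then 0 else 1 : Fin 2) = 0)).card
        rw [h0, hf, card_image_of_injective _ (Fin.castAdd_injective i j)]; simp
      · change (𝒥 1).card = (univ.filter
          (fun a : Fin (i + j) => (if (a : ℕ) < i then 0 else 1 : Fin 2) = 1)).card
        rw [h1, hg, card_image_of_injective _ (Fin.natAdd_injective j i)]; simp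
    · intro σ hσ
      rw [← hb] at hσ
      have hσ' := (mem_filter.1 hσ).2
      rw [prodMap_apply, hat_image f v (fun a => I.orderEmbOfFin hI (σ (Fin.castAdd j a))),
        hat_image g v (fun a => I.orderEmbOfFin hI (σ (Fin.natAdd i a)))]
      · intro x y hxy
        exact (I.orderEmbOfFin hI).strictMono (hσ' _ _ (by simp)
          ((Fin.strictMono_natAdd i) hxy))
      · dsimp only
        rw [h1, image_image]; rfl
      · intro x y hxy
        exact (I.orderEmbOfFin hI).strictMono (hσ' _ _ (by simp)
          ((Fin.strictMono_castAdd j) hxy))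
      · dsimp only
        rw [h0, image_image]; rfl
  · rw [hat_of_card_ne _ v hI, convo]
    symm
    refine sum_eq_zero fun J _ => sum_eq_zero fun K _ => ?_
    split_ifs with h
    · by_cases hd : Disjoint J K
      · by_cases hJ : J.card = i
        · have hK : K.card ≠ j := by
            intro hK
            exact hI (by rw [← h, card_union_of_disjoint hd, hJ, hK])
          simp [hat_of_card_ne g v hK]
        · simp [hat_of_card_ne f v hJ]
      · simp [cross_eq_zero ε γ hd]
    · rfl

/-- Exterior compositions correspond to evaluations in the envelope. -/
theorem extComp_apply_eq_multiConvo {i j : ℕ} {𝒱 : Γ → Submodule k V} [DirectSum.Decomposition 𝒱]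
    (f : MultilinearMap k (fun _ : Fin i => W) U) (g : MultilinearMap k (fun _ : Fin j => V) W)
    {γ : Fin (i * j) → Γ} (v : Fin (i * j) → V) (hv : ∀ a, v a ∈ 𝒱 (γ a)) :
    extComp ε 𝒱 f g v = multiConvo ε γ (fun 𝒥 => f (fun r => hat g v (𝒥 r))) univ := by
  let b : Fin (i * j) → Fin i := fun a => (finProdFinEquiv.symm a).1
  have hfib : ∀ r, univ.filter (b · = r)
      = univ.image (fun s : Fin j => finProdFinEquiv (r, s)) := by
    intro r
    ext a
    obtain ⟨⟨r', s⟩, rfl⟩ := finProdFinEquiv.surjective a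
    simp only [b, Equiv.symm_apply_apply, mem_filter, mem_univ, true_and, mem_image,
      EmbeddingLike.apply_eq_iff_eq, Prod.mk.injEq]
    constructor
    · rintro rfl; exact ⟨s, rfl, rfl⟩
    · rintro ⟨_, h, _⟩; exact h.symm
  have hmono : Monotone b := fun x y hxy => Fin.le_def.2 (Nat.div_le_div_right (c := j) hxy)
  have h := sum_shuffles_eq_multiConvo (ε := ε) (γ := γ) (𝒱 := 𝒱) b hmono (compMap f g) v hv
    (OrderIso.refl (Fin (i * j))).toOrderEmbedding (fun 𝒥 => f (fun r => hat g v (𝒥 r))) ?_ ?_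
  · have hu : univ.image (OrderIso.refl (Fin (i * j))).toOrderEmbedding = univ := by
      ext; simp
    rw [hu] at h
    exact h
  · intro 𝒥 h𝒥 r
    have hc : (𝒥 r).card = j := by
      by_contra hc
      exact h𝒥 (f.map_coord_zero r (hat_of_card_ne g v hc))
    rw [hc, hfib, card_image_of_injective]
    · simp
    · intro s t hst
      simpa using hst
  · intro σ hσ
    have hσ' := (mem_filter.1 hσ).2
    rw [compMap_apply]
    congr 1
    funext r
    refine hat_image g v (fun s => σ (finProdFinEquiv (r, s))) (fun s t hst => hσ' _ _ ?_ ?_) ?_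
    · simp only [b, Equiv.symm_apply_apply]
    · rw [Fin.lt_def] at hst ⊢
      simpa only [finProdFinEquiv_apply_val, add_lt_add_iff_right] using hst
    · simp only [hfib, image_image]; rfl

end

end Envelope

/-! ### Orthogonal representations on homogeneous vectors -/

section Homogeneous

variable {k Γ L V W : Type*} [Field k] [AddCommGroup Γ] [DecidableEq Γ]
  [AddCommGroup L] [Module k L] [AddCommGroup V] [Module k V] [AddCommGroup W] [Module k W]
  {ε : CommutationFactor Γ k} {𝔤 : Γ → Submodule k L} {𝒱 : Γ → Submodule k V}
  [DirectSum.Decomposition 𝔤] [DirectSum.Decomposition 𝒱]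

theorem IsAlt.smul {n : ℕ} {f : MultilinearMap k (fun _ : Fin n => V) W} (hf : IsAlt ε 𝒱 f)
    (c : k) : IsAlt ε 𝒱 (c • f) := by
  intro σ
  refine multilinear_ext_homogeneous 𝒱 fun γ v hv => ?_
  rw [permAct_apply ε 𝒱 _ _ γ v hv, smul_apply, smul_apply, smul_comm,
    ← permAct_apply ε 𝒱 σ f γ v hv, hf σ]

/-- If the unsymmetrized product is already alternating, all shuffles contribute equally. -/
theorem wedge_of_isAlt {U T : Type*} [AddCommGroup U] [Module k U] [AddCommGroup T] [Module k T]
    {i j : ℕ} (φ : U →ₗ[k] W →ₗ[k] T) {f : MultilinearMap k (fun _ : Fin i => V) U}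
    {g : MultilinearMap k (fun _ : Fin j => V) W} (h : IsAlt ε 𝒱 (prodMap φ f g)) :
    wedge ε 𝒱 φ f g
      = ((shuffles (fun a : Fin (i + j) => if (a : ℕ) < i then 0 else 1)).card : k) •
        prodMap φ f g := by
  rw [wedge, Finset.sum_congr rfl fun σ _ => h σ, Finset.sum_const, Nat.cast_smul_eq_nsmul]

theorem eq_of_form_homogeneous_left (𝒲 : Γ → Submodule k W) [DirectSum.Decomposition 𝒲]
    {B : W →ₗ[k] W →ₗ[k] k} (hB : B.Nondegenerate) {m m' : W}
    (h : ∀ a, ∀ x ∈ 𝒲 a, B x m = B x m') : m = m' := by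
  rw [← sub_eq_zero]
  refine hB.2 _ fun x => ?_
  rw [map_sub, sub_eq_zero]
  induction x using DirectSum.Decomposition.inductionOn 𝒲 with
  | zero => simp
  | homogeneous x => exact h _ _ x.2
  | add x y hx hy => simp only [map_add, LinearMap.add_apply, hx, hy]

theorem eq_of_form_homogeneous_right (𝒲 : Γ → Submodule k W) [DirectSum.Decomposition 𝒲]
    {B : W →ₗ[k] W →ₗ[k] k} (hB : B.Nondegenerate) {m m' : W}
    (h : ∀ a, ∀ x ∈ 𝒲 a, B m x = B m' x) : m = m' := by
  rw [← sub_eq_zero]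
  refine hB.1 _ fun x => ?_
  rw [map_sub, LinearMap.sub_apply, sub_eq_zero]
  induction x using DirectSum.Decomposition.inductionOn 𝒲 with
  | zero => simp
  | homogeneous x => exact h _ _ x.2
  | add x y hx hy => simp only [map_add, hx, hy]

/-- A homogeneous vector of degree `c` only pairs with the component of degree `-c`. -/
theorem IsEpsSymm.apply_decompose {𝒲 : Γ → Submodule k W} [DirectSum.Decomposition 𝒲]
    {B : W →ₗ[k] W →ₗ[k] k} (hB : IsEpsSymm ε 𝒲 B) {c d : Γ} {x : W} (hx : x ∈ 𝒲 c) (m : W) :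
    B x (DirectSum.decompose 𝒲 m d) = if c + d = 0 then B x m else 0 := by
  split_ifs with h
  · induction m using DirectSum.Decomposition.inductionOn 𝒲 with
    | zero => simp
    | @homogeneous e m =>
      by_cases he : e = d
      · subst he; rw [DirectSum.decompose_of_mem_same 𝒲 m.2]
      · rw [DirectSum.decompose_of_mem_ne 𝒲 m.2 he, map_zero, hB.degree_zero c e _ x hx m m.2]
        intro h'
        exact he (add_left_cancel (h'.trans h.symm))
    | add x y hx hy => simp only [DirectSum.decompose_add, DirectSum.add_apply,
        Submodule.coe_add, map_add, hx, hy]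
  · exact hB.degree_zero c d h x hx _ (SetLike.coe_mem _)

namespace OrthogonalRep

variable [FiniteDimensional k L] {A : QuadraticColourLieAlgebra ε 𝔤}
  (r : OrthogonalRep A.toColourLieAlgebra 𝒱)

theorem form_moment (x : L) (v w : V) : A.form x (r.moment v w) = r.form (r.rho x v) w :=
  momentMap_spec _ _ _ _ x v w

theorem rho_apply_mem {a b : Γ} {x : L} {v : V} (hx : x ∈ 𝔤 a) (hv : v ∈ 𝒱 b) :
    r.rho x v ∈ 𝒱 (a + b) := add_comm b a ▸ (r.rho_mem a x hx).1 b v hv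

theorem form_rho {a b : Γ} {x : L} {v : V} (hx : x ∈ 𝔤 a) (hv : v ∈ 𝒱 b) (w : V) :
    r.form (r.rho x v) w = -((ε a b : k) * r.form v (r.rho x w)) :=
  eq_neg_of_add_eq_zero_left ((r.rho_mem a x hx).2 b v hv w)

/-- The moment map has degree `0`. -/
theorem moment_mem {a b : Γ} {v w : V} (hv : v ∈ 𝒱 a) (hw : w ∈ 𝒱 b) :
    r.moment v w ∈ 𝔤 (a + b) := by
  have h : r.moment v w = DirectSum.decompose 𝔤 (r.moment v w) (a + b) := by
    refine eq_of_form_homogeneous_left 𝔤 A.form_nondegenerate fun c x hx => ?_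
    rw [A.form_symm.apply_decompose hx]
    split_ifs with h
    · rfl
    · rw [form_moment]
      exact r.form_symm.degree_zero (c + a) b (by rwa [add_assoc]) _ (r.rho_apply_mem hx hv) w hw
  rw [h]
  exact SetLike.coe_mem _

/-- The moment map is `ε`-antisymmetric. -/
theorem moment_antisymm {a b : Γ} {v w : V} (hv : v ∈ 𝒱 a) (hw : w ∈ 𝒱 b) :
    r.moment v w = -((ε a b : k) • r.moment w v) := by
  refine eq_of_form_homogeneous_left 𝔤 A.form_nondegenerate fun c x hx => ?_
  rw [map_neg, map_smul, form_moment, form_moment, r.form_rho hx hv,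
    r.form_symm.symm a (c + b) v hv _ (r.rho_apply_mem hx hw), ε.map_add_right]
  have := ε.val_mul_swap a c
  simp only [Units.val_mul, smul_eq_mul]
  linear_combination -(ε a b : k) * r.form (r.rho x w) v * this

/-- The moment map is equivariant. -/
theorem bracket_moment {c a b : Γ} {x : L} {v w : V} (hx : x ∈ 𝔤 c) (hv : v ∈ 𝒱 a)
    (hw : w ∈ 𝒱 b) : A.bracket x (r.moment v w)
      = r.moment (r.rho x v) w + (ε c a : k) • r.moment v (r.rho x w) := by
  refine eq_of_form_homogeneous_left 𝔤 A.form_nondegenerate fun d y hy => ?_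
  have h1 := A.ad_invariant c d (a + b) x hx y hy _ (r.moment_mem hv hw)
  rw [form_moment, r.rho_bracket c d x hx y hy] at h1
  simp only [LinearMap.sub_apply, LinearMap.smul_apply, Module.End.mul_apply, map_sub, map_smul,
    smul_eq_mul] at h1
  rw [r.form_rho hx (r.rho_apply_mem hy hv), ε.map_add_right] at h1
  rw [map_add, map_smul, form_moment, form_moment]
  have h2 := ε.val_mul_swap c d
  simp only [Units.val_mul, smul_eq_mul] at h1 ⊢
  linear_combination (ε d c : k) * h1 + (r.form (r.rho y (r.rho x v)) w
    + (ε c a : k) * r.form (r.rho y v) (r.rho x w)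
      - A.form y (A.bracket x (r.moment v w))) * h2

theorem covPsi_apply {a b c : Γ} {u v w : V} (hu : u ∈ 𝒱 a) (hv : v ∈ 𝒱 b) (hw : w ∈ 𝒱 c) :
    r.covPsi ![u, v, w] = r.rho (r.moment u v) w + (ε (a + b) c : k) • r.rho (r.moment w u) v
      + (ε a (b + c) : k) • r.rho (r.moment v w) u :=
  psi_apply ε 𝒱 _ _ a b c u v w hu hv hw

theorem covPsi_mem {a b c : Γ} {u v w : V} (hu : u ∈ 𝒱 a) (hv : v ∈ 𝒱 b) (hw : w ∈ 𝒱 c) :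
    r.covPsi ![u, v, w] ∈ 𝒱 (a + b + c) := by
  rw [r.covPsi_apply hu hv hw]
  refine Submodule.add_mem _ (Submodule.add_mem _ ?_ (Submodule.smul_mem _ _ ?_))
    (Submodule.smul_mem _ _ ?_)
  · exact r.rho_apply_mem (r.moment_mem hu hv) hw
  · rw [show a + b + c = c + a + b by abel]
    exact r.rho_apply_mem (r.moment_mem hw hu) hv
  · rw [show a + b + c = b + c + a by abel]
    exact r.rho_apply_mem (r.moment_mem hv hw) hu

theorem covPsi_swap_left {a b c : Γ} {u v w : V} (hu : u ∈ 𝒱 a) (hv : v ∈ 𝒱 b) (hw : w ∈ 𝒱 c) :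
    r.covPsi ![u, v, w] = -((ε a b : k) • r.covPsi ![v, u, w]) := by
  rw [r.covPsi_apply hu hv hw, r.covPsi_apply hv hu hw, r.moment_antisymm hu hv,
    r.moment_antisymm hw hu, r.moment_antisymm hv hw]
  simp only [ε.map_add_left, ε.map_add_right, Units.val_mul, map_neg, map_smul,
    LinearMap.neg_apply, LinearMap.smul_apply]
  have h1 := ε.val_mul_swap a b
  have h2 := ε.val_mul_swap a c
  have h3 := ε.val_mul_swap b c
  match_scalars
  · ring
  · linear_combination (-(ε b c : k)) * h2 + (ε b c : k) * h1
  · linear_combination (-(ε a b : k) * ε a c) * h3 + (ε a b : k) * ε a c * h3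

theorem covPsi_swap_right {a b c : Γ} {u v w : V} (hu : u ∈ 𝒱 a) (hv : v ∈ 𝒱 b) (hw : w ∈ 𝒱 c) :
    r.covPsi ![u, v, w] = -((ε b c : k) • r.covPsi ![u, w, v]) := by
  rw [r.covPsi_apply hu hv hw, r.covPsi_apply hu hw hv, r.moment_antisymm hu hv,
    r.moment_antisymm hw hu, r.moment_antisymm hv hw]
  simp only [ε.map_add_left, ε.map_add_right, Units.val_mul, map_neg, map_smul,
    LinearMap.neg_apply, LinearMap.smul_apply]
  have h1 := ε.val_mul_swap a b
  have h2 := ε.val_mul_swap a c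
  have h3 := ε.val_mul_swap b c
  match_scalars
  · linear_combination (ε a b : k) * h3
  · linear_combination (-(ε b c : k)) * h2
  · ring

theorem isAlt_covMu : IsAlt ε 𝒱 r.covMu := by
  refine isAlt_of_homogeneous fun x y hxy γ v hv => ?_
  obtain ⟨rfl, rfl⟩ : x = 0 ∧ y = 1 := by omega
  rw [r.covMu_apply, r.covMu_apply]
  simpa using r.moment_antisymm (hv 0) (hv 1)

theorem isAlt_covPsi : IsAlt ε 𝒱 r.covPsi := by
  refine isAlt_of_homogeneous fun x y hxy γ v hv => ?_
  have hvec : ∀ f : Fin 3 → V, f = ![f 0, f 1, f 2] := fun f => by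
    funext i; fin_cases i <;> rfl
  obtain ⟨rfl, rfl⟩ | ⟨rfl, rfl⟩ : (x = 0 ∧ y = 1) ∨ (x = 1 ∧ y = 2) := by omega
  · rw [hvec v, hvec (fun i => _)]
    exact r.covPsi_swap_left (hv 0) (hv 1) (hv 2)
  · rw [hvec v, hvec (fun i => _)]
    exact r.covPsi_swap_right (hv 0) (hv 1) (hv 2)

variable [FiniteDimensional k V] {h2 : (2 : k) ≠ 0}

/-- The speciality condition, in terms of endomorphisms of `V`. -/
theorem IsSpecial.covPsi_eq {r : OrthogonalRep A.toColourLieAlgebra 𝒱} (hr : r.IsSpecial h2)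
    (h3 : (3 : k) ≠ 0)
    {a b c : Γ} {u v w : V} (hu : u ∈ 𝒱 a) (hv : v ∈ 𝒱 b) (hw : w ∈ 𝒱 c) :
    r.covPsi ![u, v, w] = (3 : k) • (r.rho (r.moment u v) w
      - (((ε b c : k) * r.form u w) • v - r.form v w • u)) := by
  refine eq_of_form_homogeneous_right 𝒱 r.form_nondegenerate fun d z hz => ?_
  have h := congrArg (fun f => f ![u, v, w, z]) hr
  simp only [sub_apply, smul_apply,
    bianchi_apply ε 𝒱 _ a b c d u v w z hu hv hw hz, curvature_apply] at h
  change r.form (r.rho (r.moment u v) w) z - (1 / 3 : k) • (r.form (r.rho (r.moment u v) w) z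
    + (ε a (b + c) : k) * r.form (r.rho (r.moment v w) u) z
    + (ε (a + b) c : k) * r.form (r.rho (r.moment w u) v) z)
    = r.form ((muCan h2 ε 𝒱 r.form r.form_symm r.form_nondegenerate u v : Module.End k V) w) z at h
  rw [muCan_apply h2 ε 𝒱 r.form r.form_symm r.form_nondegenerate a b c u v w hu hv hw] at h
  rw [r.covPsi_apply hu hv hw]
  simp only [map_add, map_sub, map_smul, LinearMap.add_apply, LinearMap.sub_apply,
    LinearMap.smul_apply, smul_eq_mul] at h ⊢
  field_simp at h
  linear_combination -h

/-- For a special representation, `(v₁, ψ(v₂, v₃, v₄))` is antisymmetric in `v₁` and `v₂`: up to the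
factor `3` it is the value at `(v₁, v₂)` of the form twisted by `μ(v₃, v₄) - μ_can(v₃, v₄)`, which
lies in the orthogonal algebra. -/
theorem IsSpecial.form_covPsi_swap {r : OrthogonalRep A.toColourLieAlgebra 𝒱}
    (hr : r.IsSpecial h2) (h3 : (3 : k) ≠ 0) {a b c d : Γ} {u v w z : V} (hu : u ∈ 𝒱 a)
    (hv : v ∈ 𝒱 b) (hw : w ∈ 𝒱 c) (hz : z ∈ 𝒱 d) :
    r.form u (r.covPsi ![v, w, z]) = -((ε a b : k) * r.form v (r.covPsi ![u, w, z])) := by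
  have hX := r.moment_mem hw hz
  have hY : r.form v (r.rho (r.moment w z) u)
      = -((ε b c : k) * ε b d * ε b a * ε c a * ε d a * r.form u (r.rho (r.moment w z) v)) := by
    rw [r.form_symm.symm b _ v hv _ (r.rho_apply_mem hX hu), r.form_rho hX hu]
    simp only [ε.map_add_left, ε.map_add_right, Units.val_mul]
    ring
  have hvw := r.form_symm.symm b c v hv w hw
  have hzu := r.form_symm.symm d a z hz u hu
  have hwu := r.form_symm.symm c a w hw u hu
  have hvz := r.form_symm.symm b d v hv z hz
  -- as the form has degree `0`, a non-zero value determines the degree of one of its arguments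
  have E1 : ((ε a b : k) * ε a c - 1) * r.form w v = 0 := by
    by_cases h : b + c = 0
    · rw [← Units.val_mul, ← ε.map_add_right, h, ε.zero_right]; simp
    · rw [r.form_symm.degree_zero c b (by rwa [add_comm]) w hw v hv, mul_zero]
  have E2 : ((ε b c : k) - ε a b) * r.form u w = 0 := by
    by_cases h : a + c = 0
    · rw [eq_neg_of_add_eq_zero_right h, ε.neg_right]; simp
    · rw [r.form_symm.degree_zero a c h u hu w hw, mul_zero]
  rw [r.covPsi_swap_left hv hw hz, r.covPsi_swap_right hw hv hz, r.covPsi_swap_left hu hw hz,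
    r.covPsi_swap_right hw hu hz, hr.covPsi_eq h3 hw hz hv, hr.covPsi_eq h3 hw hz hu]
  simp only [map_neg, map_smul, map_sub, smul_eq_mul, hY, hvw, hzu, hwu, hvz]
  have h_ab := ε.val_mul_swap a b
  have h_ac := ε.val_mul_swap a c
  have h_ad := ε.val_mul_swap a d
  have h_bd := ε.val_mul_swap b d
  generalize r.form u (r.rho (r.moment w z) v) = X
  generalize r.form w v = wv at *
  generalize r.form u z = uz at *
  generalize r.form u w = uw at *
  generalize r.form z v = zv at *
  linear_combination -3 * (ε b c : k) * ε b d * X * (h_ab + ((ε a b : k) * ε b a) * h_ac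
      + ((ε a b : k) * ε b a * ε a c * ε c a) * h_ad)
    - 3 * (ε b c : k) * wv * uz * h_bd + 3 * (ε b c : k) * uz * E1
    + 3 * (ε b c : k) * wv * uz * ε a b * ε a c * h_ad
    + 3 * (ε b d : k) * zv * E2 - 3 * (ε b d : k) * zv * uw * ε a b * h_ac
    - 3 * (ε b d : k) * zv * uw * ε a b * ε a c * ε c a * h_ad

/-- Moving the last vector to the front: three adjacent exchanges. -/
theorem IsSpecial.form_covPsi_rotate {r : OrthogonalRep A.toColourLieAlgebra 𝒱}
    (hr : r.IsSpecial h2) (h3 : (3 : k) ≠ 0) {a b c d : Γ} {u v w z : V} (hu : u ∈ 𝒱 a)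
    (hv : v ∈ 𝒱 b) (hw : w ∈ 𝒱 c) (hz : z ∈ 𝒱 d) :
    r.form u (r.covPsi ![v, w, z])
      = -((ε (a + b + c) d : k) * r.form z (r.covPsi ![u, v, w])) := by
  rw [r.covPsi_swap_right hv hw hz, r.covPsi_swap_left hv hz hw]
  simp only [map_neg, map_smul, smul_eq_mul]
  rw [hr.form_covPsi_swap h3 hu hz hv hw]
  simp only [ε.map_add_left, Units.val_mul]
  ring

/-- For a special representation the four terms in the definition of `Q` coincide. -/
theorem IsSpecial.covQ_eq {r : OrthogonalRep A.toColourLieAlgebra 𝒱}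
    (hr : r.IsSpecial h2) (h3 : (3 : k) ≠ 0) {a b c d : Γ} {u v w z : V} (hu : u ∈ 𝒱 a)
    (hv : v ∈ 𝒱 b) (hw : w ∈ 𝒱 c) (hz : z ∈ 𝒱 d) :
    r.covQ ![u, v, w, z] = 4 * r.form u (r.covPsi ![v, w, z]) := by
  have e1 := hr.form_covPsi_rotate h3 hu hv hw hz
  have e2 := hr.form_covPsi_rotate h3 hz hu hv hw
  have e3 := hr.form_covPsi_rotate h3 hw hz hu hv
  rw [covQ, quartic_apply ε 𝒱 r.form r.covPsi a b c d u v w z hu hv hw hz]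
  simp only [ε.map_add_left, ε.map_add_right, Units.val_mul] at *
  have h_bc := ε.val_mul_swap b c
  have h_bd := ε.val_mul_swap b d
  have h_cd := ε.val_mul_swap c d
  generalize r.form u (r.covPsi ![v, w, z]) = S1 at *
  generalize r.form z (r.covPsi ![u, v, w]) = S2 at *
  generalize r.form w (r.covPsi ![z, u, v]) = S3 at *
  generalize r.form v (r.covPsi ![w, z, u]) = S4 at *
  have f3 : S1 = (ε a c : k) * ε a d * (ε b c * ε b d) * S3 := by
    linear_combination e1 - (ε a d : k) * ε b d * ε c d * e2
      + (ε a d : k) * ε b d * ε a c * ε b c * S3 * h_cd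
  have f4 : S1 = -((ε a b : k) * ε a c * ε a d * S4) := by
    linear_combination f3 + (ε a c : k) * ε a d * (ε b c * ε b d) * e3
      - (ε a c : k) * ε a d * ε a b * S4 * (h_bc + ε b c * ε c b * h_bd)
  linear_combination -e1 - f3 - f4

/-- The quadrilinear form `(v₁, ψ(v₂, v₃, v₄))` is alternating. -/
theorem IsSpecial.isAlt_form_covPsi {r : OrthogonalRep A.toColourLieAlgebra 𝒱}
    (hr : r.IsSpecial h2) (h3 : (3 : k) ≠ 0) :
    IsAlt ε 𝒱 (prodMap (i := 1) (j := 3) r.form (idMap k V) r.covPsi) := by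
  refine isAlt_of_homogeneous fun x y hxy γ v hv => ?_
  have hS : ∀ f : Fin 4 → V, prodMap (i := 1) (j := 3) r.form (idMap k V) r.covPsi f
      = r.form (f 0) (r.covPsi ![f 1, f 2, f 3]) := by
    intro f
    rw [prodMap_apply]
    have : (fun i : Fin 3 => f (Fin.natAdd 1 i)) = ![f 1, f 2, f 3] := by
      funext i; fin_cases i <;> rfl
    rw [this]; rfl
  rw [hS v, hS (fun i => _)]
  obtain ⟨rfl, rfl⟩ | ⟨rfl, rfl⟩ | ⟨rfl, rfl⟩ :
    (x = 0 ∧ y = 1) ∨ (x = 1 ∧ y = 2) ∨ (x = 2 ∧ y = 3) := by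
      have hcases : ∀ x y : Fin 4, (y : ℕ) = x + 1 →
        (x = 0 ∧ y = 1) ∨ (x = 1 ∧ y = 2) ∨ (x = 2 ∧ y = 3) := by decide
      exact hcases x y hxy
  · exact hr.form_covPsi_swap h3 (hv 0) (hv 1) (hv 2) (hv 3)
  · rw [r.covPsi_swap_left (hv 1) (hv 2) (hv 3), map_neg, map_smul]; rfl
  · rw [r.covPsi_swap_right (hv 1) (hv 2) (hv 3), map_neg, map_smul]; rfl

theorem IsSpecial.covQ_eq_smul {r : OrthogonalRep A.toColourLieAlgebra 𝒱}
    (hr : r.IsSpecial h2) (h3 : (3 : k) ≠ 0) :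
    r.covQ = (4 : k) • prodMap (i := 1) (j := 3) r.form (idMap k V) r.covPsi := by
  refine multilinear_ext_homogeneous 𝒱 fun γ v hv => ?_
  have e : v = ![v 0, v 1, v 2, v 3] := by funext i; fin_cases i <;> rfl
  have e' : (fun i : Fin 3 => v (Fin.natAdd 1 i)) = ![v 1, v 2, v 3] := by
    funext i; fin_cases i <;> rfl
  rw [smul_apply, prodMap_apply, e']
  conv_lhs => rw [e]
  exact hr.covQ_eq h3 (hv 0) (hv 1) (hv 2) (hv 3)

theorem IsSpecial.isAlt_covQ {r : OrthogonalRep A.toColourLieAlgebra 𝒱}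
    (hr : r.IsSpecial h2) (h3 : (3 : k) ≠ 0) : IsAlt ε 𝒱 r.covQ := by
  rw [hr.covQ_eq_smul h3]
  exact (hr.isAlt_form_covPsi h3).smul 4

/-- `Q` is the exterior product of the identity and `ψ`, taken with respect to the form. -/
theorem IsSpecial.wedge_id_covPsi {r : OrthogonalRep A.toColourLieAlgebra 𝒱}
    (hr : r.IsSpecial h2) (h3 : (3 : k) ≠ 0) :
    wedge (i := 1) (j := 3) ε 𝒱 r.form (idMap k V) r.covPsi = r.covQ := by
  rw [wedge_of_isAlt r.form (hr.isAlt_form_covPsi h3), hr.covQ_eq_smul h3,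
    show (shuffles (fun a : Fin (1 + 3) => if (a : ℕ) < 1 then 0 else 1)).card = 4 by decide]
  norm_num

/-- Both shuffles contribute `μ`. -/
theorem wedge_id_id : wedge (i := 1) (j := 1) ε 𝒱 r.moment (idMap k V) (idMap k V)
    = (2 : k) • r.covMu := by
  rw [wedge_of_isAlt r.moment r.isAlt_covMu,
    show (shuffles (fun a : Fin (1 + 1) => if (a : ℕ) < 1 then 0 else 1)).card = 2 by decide]
  norm_num
  rfl

/-- `ψ` is the exterior product of `μ` and the identity, taken with respect to `ρ`. -/
theorem wedge_covMu_id : wedge (i := 2) (j := 1) ε 𝒱 r.rho r.covMu (idMap k V) = r.covPsi := by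
  have hsh : shuffles (fun a : Fin (2 + 1) => if (a : ℕ) < 2 then 0 else 1)
      = {1, Equiv.swap 1 2, Equiv.swap 0 1 * Equiv.swap 1 2} := by decide
  rw [wedge, hsh, Finset.sum_insert (by decide), Finset.sum_insert (by decide),
    Finset.sum_singleton, permAct_one, permAct_mul]
  refine multilinear_ext_homogeneous 𝒱 fun γ v hv => ?_
  have e : v = ![v 0, v 1, v 2] := by funext i; fin_cases i <;> rfl
  conv_rhs => rw [e]
  rw [r.covPsi_apply (hv 0) (hv 1) (hv 2)]
  have hT : ∀ f : Fin 3 → V, prodMap (i := 2) (j := 1) r.rho r.covMu (idMap k V) f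
      = r.rho (r.moment (f 0) (f 1)) (f 2) := fun f => by
    rw [prodMap_apply, covMu_apply]; rfl
  rw [add_apply, add_apply, permAct_apply ε 𝒱 _ _ γ v hv, permAct_apply ε 𝒱 _ _ γ v hv,
    permAct_apply ε 𝒱 _ _ (fun i => γ (Equiv.swap 0 1 i)) _ (fun i => hv _), hT, hT, hT,
    multiplier_swap ε 1 2 rfl, multiplier_swap ε 0 1 rfl, multiplier_swap ε 1 2 rfl]
  change r.rho (r.moment (v 0) (v 1)) (v 2)
    + (-(ε (γ 1) (γ 2) : k) • r.rho (r.moment (v 0) (v 2)) (v 1)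
    + -(ε (γ 0) (γ 1) : k) • -(ε (γ 0) (γ 2) : k) • r.rho (r.moment (v 1) (v 2)) (v 0)) = _
  rw [r.moment_antisymm (hv 0) (hv 2)]
  simp only [ε.map_add_left, ε.map_add_right, Units.val_mul, map_neg, map_smul,
    LinearMap.neg_apply, LinearMap.smul_apply]
  module

end OrthogonalRep

end Homogeneous

/-! ### Bilinear maps extended to the envelope -/

section Extend

noncomputable section

open Finset

variable {k Γ U V W T S ι : Type*} [Field k] [AddCommGroup Γ] [DecidableEq Γ]
  [AddCommGroup U] [Module k U] [AddCommGroup V] [Module k V] [AddCommGroup W] [Module k W]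
  [AddCommGroup T] [Module k T] [AddCommGroup S] [Module k S] [Fintype ι] [LinearOrder ι]

/-- The extension of a bilinear map to the envelope,
`φ(∑ e_J ⊗ x_J, ∑ e_K ⊗ y_K) = ∑ e_J e_K ⊗ φ(x_J, y_K)`. -/
def extend (ε : CommutationFactor Γ k) (γ : ι → Γ) (φ : U →ₗ[k] W →ₗ[k] T)
    (x : Finset ι → U) (y : Finset ι → W) : Finset ι → T :=
  convo ε γ (fun J K => φ (x J) (y K))

/-- The coefficients `x` define an element `∑ e_J ⊗ x J` of total degree `0` of length `r`: it only
involves sets `J` with `r` elements. -/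
def IsHomog (γ : ι → Γ) (𝒲 : Γ → Submodule k W) (r : ℕ) (x : Finset ι → W) : Prop :=
  ∀ J, x J ∈ 𝒲 (∑ i ∈ J, γ i) ∧ (J.card ≠ r → x J = 0)

/-- The field `k`, placed in degree `0`. -/
def scalarGrading (Γ k : Type*) [AddCommGroup Γ] [DecidableEq Γ] [Field k] (a : Γ) :
    Submodule k k := if a = 0 then ⊤ else ⊥

variable {ε : CommutationFactor Γ k} {γ : ι → Γ}

theorem extend_smul_left (φ : U →ₗ[k] W →ₗ[k] T) (c : k) (x : Finset ι → U) (y : Finset ι → W) :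
    extend ε γ φ (c • x) y = c • extend ε γ φ x y := by
  rw [extend, extend, ← convo_smul]
  simp

theorem extend_smul_right (φ : U →ₗ[k] W →ₗ[k] T) (c : k) (x : Finset ι → U) (y : Finset ι → W) :
    extend ε γ φ x (c • y) = c • extend ε γ φ x y := by
  rw [extend, extend, ← convo_smul]
  simp

theorem extend_zero_left (φ : U →ₗ[k] W →ₗ[k] T) (y : Finset ι → W) :
    extend ε γ φ 0 y = 0 := by
  simpa using extend_smul_left (ε := ε) (γ := γ) φ 0 0 y

theorem extend_zero_right (φ : U →ₗ[k] W →ₗ[k] T) (x : Finset ι → U) :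
    extend ε γ φ x 0 = 0 := by
  simpa using extend_smul_right (ε := ε) (γ := γ) φ 0 x 0

theorem extend_extend_left (φ : U →ₗ[k] W →ₗ[k] T) (χ : S →ₗ[k] V →ₗ[k] U) (x : Finset ι → S)
    (y : Finset ι → V) (z : Finset ι → W) : extend ε γ φ (extend ε γ χ x y) z
      = convo ε γ (fun J M => convo ε γ (fun K L => φ (χ (x J) (y K)) (z L)) M) := by
  rw [← convo_assoc]
  exact congrArg (convo ε γ) (funext fun M => funext fun L => map_convo (φ.flip (z L)) _ M)

theorem extend_extend_right (φ : U →ₗ[k] W →ₗ[k] T) (χ : S →ₗ[k] V →ₗ[k] W) (x : Finset ι → U)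
    (y : Finset ι → S) (z : Finset ι → V) : extend ε γ φ x (extend ε γ χ y z)
      = convo ε γ (fun J M => convo ε γ (fun K L => φ (x J) (χ (y K) (z L))) M) :=
  congrArg (convo ε γ) (funext fun J => funext fun M => map_convo (φ (x J)) _ M)

/-- The envelope preserves associativity relations between bilinear maps. -/
theorem extend_assoc {X : Type*} [AddCommGroup X] [Module k X]
    (φ : U →ₗ[k] W →ₗ[k] T) (χ : S →ₗ[k] V →ₗ[k] U)
    (φ' : S →ₗ[k] X →ₗ[k] T) (χ' : V →ₗ[k] W →ₗ[k] X)
    (h : ∀ a b c, φ (χ a b) c = φ' a (χ' b c)) (x : Finset ι → S) (y : Finset ι → V)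
    (z : Finset ι → W) :
    extend ε γ φ (extend ε γ χ x y) z = extend ε γ φ' x (extend ε γ χ' y z) := by
  rw [extend_extend_left, extend_extend_right]
  simp only [h]

theorem IsHomog.extend {𝒰 : Γ → Submodule k U} {𝒲 : Γ → Submodule k W} {𝒯 : Γ → Submodule k T}
    {φ : U →ₗ[k] W →ₗ[k] T} (hφ : ∀ a b, ∀ u ∈ 𝒰 a, ∀ w ∈ 𝒲 b, φ u w ∈ 𝒯 (a + b))
    {r s : ℕ} {x : Finset ι → U} {y : Finset ι → W} (hx : IsHomog γ 𝒰 r x)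
    (hy : IsHomog γ 𝒲 s y) : IsHomog γ 𝒯 (r + s) (extend ε γ φ x y) := by
  refine fun I => ⟨?_, fun hI => ?_⟩
  · refine Submodule.sum_mem _ fun J _ => Submodule.sum_mem _ fun K _ => ?_
    split_ifs with h
    · by_cases hd : Disjoint J K
      · rw [← h, sum_union hd]
        exact Submodule.smul_mem _ _ (hφ _ _ _ (hx J).1 _ (hy K).1)
      · rw [cross_eq_zero ε γ hd, zero_smul]
        exact Submodule.zero_mem _
    · exact Submodule.zero_mem _
  · refine sum_eq_zero fun J _ => sum_eq_zero fun K _ => ?_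
    split_ifs with h
    · by_cases hd : Disjoint J K
      · by_cases hJ : J.card = r
        · have hK : K.card ≠ s := fun hK =>
            hI (by rw [← h, card_union_of_disjoint hd, hJ, hK])
          change cross ε γ J K • φ (x J) (y K) = 0
          rw [(hy K).2 hK, map_zero, smul_zero]
        · change cross ε γ J K • φ (x J) (y K) = 0
          rw [(hx J).2 hJ, map_zero, LinearMap.zero_apply, smul_zero]
      · rw [cross_eq_zero ε γ hd, zero_smul]
    · rfl

theorem hat_isHomog {r : ℕ} {𝒱 : Γ → Submodule k V} {𝒲 : Γ → Submodule k W}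
    {f : MultilinearMap k (fun _ : Fin r => V) W}
    (hf : ∀ (δ : Fin r → Γ) (w : Fin r → V), (∀ i, w i ∈ 𝒱 (δ i)) → f w ∈ 𝒲 (∑ i, δ i))
    {v : ι → V} (hv : ∀ i, v i ∈ 𝒱 (γ i)) : IsHomog γ 𝒲 r (hat f v) := by
  refine fun J => ⟨?_, fun hJ => hat_of_card_ne f v hJ⟩
  by_cases h : J.card = r
  · have hs : ∑ i ∈ J, γ i = ∑ a, γ (J.orderEmbOfFin h a) := by
      conv_lhs => rw [← image_orderEmbOfFin_univ J h]
      exact sum_image fun _ _ _ _ h' => (J.orderEmbOfFin h).injective h'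
    rw [hat, dif_pos h, hs]
    exact hf _ _ fun i => hv _
  · rw [hat_of_card_ne f v h]
    exact Submodule.zero_mem _

/-- Exchanging two factors of a product in the envelope. -/
theorem convo_swap (c : k) {F G : Finset ι → Finset ι → W}
    (h : ∀ J K, F J K = (c * swapFactor ε γ J K) • G K J) :
    convo ε γ F = c • convo ε γ G := by
  rw [convo_comm G, ← convo_smul]
  simp only [smul_smul]
  exact convo_congr fun J K _ => h J K

theorem swapFactor_eq_one {J K : Finset ι} (hK : Even K.card) (h0 : ∑ i ∈ K, γ i = 0) :
    swapFactor ε γ J K = 1 := by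
  rw [swapFactor, h0, ε.zero_right, (hK.mul_left _).neg_one_pow]; simp

theorem swapFactor_of_odd {J K : Finset ι} (hJ : Odd J.card) (hK : Odd K.card) :
    swapFactor ε γ J K = -(ε (∑ i ∈ J, γ i) (∑ i ∈ K, γ i) : k) := by
  rw [swapFactor, (hJ.mul hK).neg_one_pow, neg_one_mul]

theorem swapFactor_of_even {J K : Finset ι} (hJ : Even J.card) :
    swapFactor ε γ J K = (ε (∑ i ∈ J, γ i) (∑ i ∈ K, γ i) : k) := by
  rw [swapFactor, (hJ.mul_right _).neg_one_pow, one_mul]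

/-- A commutation rule involving `ε` becomes one with a sign only; two odd elements contribute the
additional sign `-1`. -/
theorem extend_swap_odd {φ : U →ₗ[k] W →ₗ[k] T} {φ' : W →ₗ[k] U →ₗ[k] T} (c : k)
    {𝒰 : Γ → Submodule k U} {𝒲 : Γ → Submodule k W}
    (h : ∀ a b, ∀ u ∈ 𝒰 a, ∀ w ∈ 𝒲 b, φ u w = (c * (ε a b : k)) • φ' w u)
    {r s : ℕ} (hr : Odd r) (hs : Odd s) {x : Finset ι → U} {y : Finset ι → W}
    (hx : IsHomog γ 𝒰 r x) (hy : IsHomog γ 𝒲 s y) :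
    extend ε γ φ x y = -c • extend ε γ φ' y x := by
  refine convo_swap (-c) fun J K => ?_
  by_cases hJ : J.card = r
  · by_cases hK : K.card = s
    · rw [swapFactor_of_odd (hJ ▸ hr) (hK ▸ hs), neg_mul_neg, h _ _ _ (hx J).1 _ (hy K).1]
    · simp [(hy K).2 hK]
  · simp [(hx J).2 hJ]

/-- The analogue of `extend_swap_odd` when one of the elements is even. -/
theorem extend_swap_even {φ : U →ₗ[k] W →ₗ[k] T} {φ' : W →ₗ[k] U →ₗ[k] T} (c : k)
    {𝒰 : Γ → Submodule k U} {𝒲 : Γ → Submodule k W}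
    (h : ∀ a b, ∀ u ∈ 𝒰 a, ∀ w ∈ 𝒲 b, φ u w = (c * (ε a b : k)) • φ' w u)
    {r s : ℕ} (hr : Even r) {x : Finset ι → U} {y : Finset ι → W}
    (hx : IsHomog γ 𝒰 r x) (hy : IsHomog γ 𝒲 s y) :
    extend ε γ φ x y = c • extend ε γ φ' y x := by
  refine convo_swap c fun J K => ?_
  by_cases hJ : J.card = r
  · rw [swapFactor_of_even (hJ ▸ hr), h _ _ _ (hx J).1 _ (hy K).1]
  · simp [(hx J).2 hJ]

end

end Extend

/-! ### The identities in the envelope -/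

section Identities

open Finset

variable {k Γ L V ι : Type*} [Field k] [AddCommGroup Γ] [DecidableEq Γ]
  [AddCommGroup L] [Module k L] [AddCommGroup V] [Module k V] [Fintype ι] [LinearOrder ι]
  {ε : CommutationFactor Γ k} {𝔤 : Γ → Submodule k L} {𝒱 : Γ → Submodule k V}
  [DirectSum.Decomposition 𝔤] [DirectSum.Decomposition 𝒱] [FiniteDimensional k L]
  {A : QuadraticColourLieAlgebra ε 𝔤} {γ : ι → Γ}

theorem extend_bracket_self (h2 : (2 : k) ≠ 0) {m : ℕ} (hm : Even m) {x : Finset ι → L}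
    (hx : IsHomog γ 𝔤 m x) : extend ε γ A.bracket x x = 0 := by
  have h := extend_swap_even (ε := ε) (φ := A.bracket) (φ' := A.bracket) (-1)
    (fun a b u hu w hw => by rw [A.antisymm a b u hu w hw, neg_one_mul, neg_smul]) hm hx hx
  rw [neg_one_smul, eq_neg_iff_add_eq_zero, ← two_smul k] at h
  exact (smul_eq_zero.1 h).resolve_left h2

namespace OrthogonalRep

variable (r : OrthogonalRep A.toColourLieAlgebra 𝒱)

theorem extend_moment_symm {m n : ℕ} (hm : Odd m) (hn : Odd n) {x y : Finset ι → V}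
    (hx : IsHomog γ 𝒱 m x) (hy : IsHomog γ 𝒱 n y) :
    extend ε γ r.moment x y = extend ε γ r.moment y x := by
  rw [extend_swap_odd (φ := r.moment) (φ' := r.moment) (-1) (fun a b u hu w hw => ?_) hm hn hx hy]
  · simp
  · rw [r.moment_antisymm hu hw, neg_one_mul, neg_smul]

theorem extend_form_antisymm {m n : ℕ} (hm : Odd m) (hn : Odd n) {x y : Finset ι → V}
    (hx : IsHomog γ 𝒱 m x) (hy : IsHomog γ 𝒱 n y) :
    extend ε γ r.form x y = -extend ε γ r.form y x := by
  rw [extend_swap_odd (φ := r.form) (φ' := r.form) 1 (fun a b u hu w hw => ?_) hm hn hx hy]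
  · simp
  · rw [r.form_symm.symm a b u hu w hw, one_mul, smul_eq_mul]

theorem extend_form_self (h2 : (2 : k) ≠ 0) {m : ℕ} (hm : Odd m) {x : Finset ι → V}
    (hx : IsHomog γ 𝒱 m x) : extend ε γ r.form x x = 0 := by
  have h := r.extend_form_antisymm hm hm hx hx
  rw [eq_neg_iff_add_eq_zero, ← two_smul k] at h
  exact (smul_eq_zero.1 h).resolve_left h2

theorem extend_bracket_moment {m n p : ℕ} (hm : Even m) {X : Finset ι → L} {x y : Finset ι → V}
    (hX : IsHomog γ 𝔤 m X) (hx : IsHomog γ 𝒱 n x) (hy : IsHomog γ 𝒱 p y) :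
    extend ε γ A.bracket X (extend ε γ r.moment x y)
      = extend ε γ r.moment (extend ε γ r.rho X x) y
        + extend ε γ r.moment x (extend ε γ r.rho X y) := by
  have h1 : ∀ J K M, A.bracket (X J) (r.moment (x K) (y M))
      = r.moment (r.rho (X J) (x K)) (y M)
        + (ε (∑ i ∈ J, γ i) (∑ i ∈ K, γ i) : k) • r.moment (x K) (r.rho (X J) (y M)) :=
    fun J K M => r.bracket_moment (hX J).1 (hx K).1 (hy M).1
  rw [extend_extend_right, extend_extend_left, extend_extend_right]
  simp only [h1, convo_add, Pi.add_apply]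
  rw [add_right_inj, ← convo_assoc, ← convo_assoc]
  refine congrArg (convo ε γ) (funext fun M => funext fun N => ?_)
  have h := convo_swap (ε := ε) (γ := γ) (1 : k)
    (F := fun J K => (ε (∑ i ∈ J, γ i) (∑ i ∈ K, γ i) : k) • r.moment (x K) (r.rho (X J) (y N)))
    (G := fun K J => r.moment (x K) (r.rho (X J) (y N))) fun J K => ?_
  · rw [one_smul] at h
    exact congrFun h M
  by_cases hJ : J.card = m
  · rw [swapFactor_of_even (hJ ▸ hm), one_mul]
  · simp [(hX J).2 hJ]

variable [FiniteDimensional k V] {h2 : (2 : k) ≠ 0}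
  {r : OrthogonalRep A.toColourLieAlgebra 𝒱}

/-- The speciality condition in the envelope, where elements of odd length of `V` obey the rules of
a symplectic space. -/
theorem IsSpecial.extend_rho_moment (hr : r.IsSpecial h2) (h3 : (3 : k) ≠ 0)
    {m n p : ℕ} (hn : Odd n) (hp : Odd p) {x y z : Finset ι → V}
    (hx : IsHomog γ 𝒱 m x) (hy : IsHomog γ 𝒱 n y) (hz : IsHomog γ 𝒱 p z) :
    extend ε γ r.rho (extend ε γ r.moment x y) z
      = (1 / 3 : k) • convo ε γ (fun J M => convo ε γ (fun K N => r.covPsi ![x J, y K, z N]) M)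
        - extend ε γ (LinearMap.lsmul k V : k →ₗ[k] V →ₗ[k] V) (extend ε γ r.form x z) y
        - extend ε γ (LinearMap.lsmul k V : k →ₗ[k] V →ₗ[k] V) (extend ε γ r.form y z) x := by
  have h1 : ∀ J K N, r.rho (r.moment (x J) (y K)) (z N)
      = (1 / 3 : k) • r.covPsi ![x J, y K, z N]
        + ((((ε (∑ i ∈ K, γ i) (∑ i ∈ N, γ i) : k) * r.form (x J) (z N)) • y K)
        + -(r.form (y K) (z N) • x J)) := by
    intro J K N
    rw [hr.covPsi_eq h3 (hx J).1 (hy K).1 (hz N).1, smul_smul, one_div_mul_cancel h3]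
    module
  have h4 : convo ε γ (fun J M => convo ε γ (fun K N =>
      ((ε (∑ i ∈ K, γ i) (∑ i ∈ N, γ i) : k) * r.form (x J) (z N)) • y K) M)
      = -extend ε γ (LinearMap.lsmul k V : k →ₗ[k] V →ₗ[k] V) (extend ε γ r.form x z) y := by
    rw [extend_extend_left, ← convo_neg]
    refine congrArg (convo ε γ) (funext fun J => funext fun M => ?_)
    have h := convo_swap (ε := ε) (γ := γ) (-1 : k)
      (F := fun K N => ((ε (∑ i ∈ K, γ i) (∑ i ∈ N, γ i) : k) * r.form (x J) (z N)) • y K)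
      (G := fun N K => r.form (x J) (z N) • y K) fun K N => ?_
    · rw [neg_one_smul] at h
      exact congrFun h M
    by_cases hK : K.card = n
    · by_cases hN : N.card = p
      · rw [swapFactor_of_odd (hK ▸ hn) (hN ▸ hp), neg_one_mul, neg_neg, mul_smul]
      · simp [(hz N).2 hN]
    · simp [(hy K).2 hK]
  have h5 : convo ε γ (fun J M => convo ε γ (fun K N => r.form (y K) (z N) • x J) M)
      = extend ε γ (LinearMap.lsmul k V : k →ₗ[k] V →ₗ[k] V) (extend ε γ r.form y z) x := by
    -- values of the form are even of degree `0`, so they can be moved past `x`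
    have hs : IsHomog γ (scalarGrading Γ k) (n + p) (extend ε γ r.form y z) := by
      refine hy.extend (fun a b u hu w hw => ?_) hz
      rw [scalarGrading]
      split_ifs with h
      · trivial
      · exact r.form_symm.degree_zero a b h u hu w hw
    have e : convo ε γ (fun J M => convo ε γ (fun K N => r.form (y K) (z N) • x J) M)
        = convo ε γ (fun J M => extend ε γ r.form y z M • x J) :=
      congrArg (convo ε γ) (funext fun J => funext fun M =>
        (map_convo (LinearMap.toSpanSingleton k V (x J)) _ M).symm)
    rw [e]
    refine (convo_swap 1 fun J M => ?_).trans (one_smul k _)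
    by_cases hM : M.card = n + p
    · by_cases h0 : ∑ i ∈ M, γ i = 0
      · rw [swapFactor_eq_one (hM ▸ hn.add_odd hp) h0, one_mul, one_smul]; rfl
      · have := (hs M).1
        rw [scalarGrading, if_neg h0, Submodule.mem_bot] at this
        simp [this]
    · simp [(hs M).2 hM]
  rw [extend_extend_left]
  simp only [h1, convo_add, convo_smul, convo_neg, Pi.add_apply, Pi.smul_apply, Pi.neg_apply]
  rw [h4, h5]
  abel

theorem hat_idMap_isHomog {v : ι → V} (hv : ∀ i, v i ∈ 𝒱 (γ i)) :
    IsHomog γ 𝒱 1 (hat (idMap k V) v) :=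
  hat_isHomog (fun δ w hw => by
    rw [show ∑ i, δ i = δ 0 by simp]; exact hw 0) hv

theorem hat_covMu_isHomog {v : ι → V} (hv : ∀ i, v i ∈ 𝒱 (γ i)) :
    IsHomog γ 𝔤 2 (hat r.covMu v) :=
  hat_isHomog (fun δ w hw => by
    rw [r.covMu_apply, Fin.sum_univ_two]; exact r.moment_mem (hw 0) (hw 1)) hv

theorem hat_covPsi_isHomog {v : ι → V} (hv : ∀ i, v i ∈ 𝒱 (γ i)) :
    IsHomog γ 𝒱 3 (hat r.covPsi v) :=
  hat_isHomog (fun δ w hw => by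
    have e : w = ![w 0, w 1, w 2] := by funext i; fin_cases i <;> rfl
    rw [e, Fin.sum_univ_three]; exact r.covPsi_mem (hw 0) (hw 1) (hw 2)) hv

theorem extend_moment_id_id {v : ι → V} (hv : ∀ i, v i ∈ 𝒱 (γ i)) :
    extend ε γ r.moment (hat (idMap k V) v) (hat (idMap k V) v)
    = (2 : k) • hat r.covMu v := by
  rw [← hat_smul, ← r.wedge_id_id, hat_wedge r.moment _ _ v hv]; rfl

theorem extend_rho_covMu_id {v : ι → V} (hv : ∀ i, v i ∈ 𝒱 (γ i)) :
    extend ε γ r.rho (hat r.covMu v) (hat (idMap k V) v)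
    = hat r.covPsi v := by
  rw [← r.wedge_covMu_id, hat_wedge r.rho _ _ v hv]; rfl

theorem IsSpecial.extend_form_id_covPsi (hr : r.IsSpecial h2) (h3 : (3 : k) ≠ 0)
    {v : ι → V} (hv : ∀ i, v i ∈ 𝒱 (γ i)) :
    extend ε γ r.form (hat (idMap k V) v) (hat r.covPsi v) = hat r.covQ v := by
  rw [← hr.wedge_id_covPsi h3, hat_wedge r.form _ _ v hv]; rfl

end OrthogonalRep

end Identities

/-! ### Covariants of the generic vector -/

section Generic

open Finset

variable {k Γ L V ι : Type*} [Field k] [AddCommGroup Γ] [DecidableEq Γ]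
  [AddCommGroup L] [Module k L] [AddCommGroup V] [Module k V] [Fintype ι] [LinearOrder ι]
  {ε : CommutationFactor Γ k} {𝔤 : Γ → Submodule k L} {𝒱 : Γ → Submodule k V}
  [DirectSum.Decomposition 𝔤] [DirectSum.Decomposition 𝒱] [FiniteDimensional k L]
  {A : QuadraticColourLieAlgebra ε 𝔤} {γ : ι → Γ} [FiniteDimensional k V] {h2 : (2 : k) ≠ 0}
  {r : OrthogonalRep A.toColourLieAlgebra 𝒱}

namespace OrthogonalRep

/-- `μ(v, ψ(v)) = 0`: this is half of `[μ(v), μ(v, v)] = 0`, expanded by equivariance. -/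
theorem extend_moment_id_covPsi (h2 : (2 : k) ≠ 0) {v : ι → V} (hv : ∀ i, v i ∈ 𝒱 (γ i)) :
    extend ε γ r.moment (hat (idMap k V) v) (hat r.covPsi v) = 0 := by
  have hid := hat_idMap_isHomog (𝒱 := 𝒱) hv
  have hM := hat_covMu_isHomog (r := r) hv
  have hP := hat_covPsi_isHomog (r := r) hv
  have h := r.extend_bracket_moment even_two hM hid hid
  rw [r.extend_moment_id_id hv, extend_smul_right, extend_bracket_self h2 even_two hM, smul_zero,
    r.extend_rho_covMu_id hv, r.extend_moment_symm (by decide) odd_one hP hid, ← two_smul k] at h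
  exact (smul_eq_zero.1 h.symm).resolve_left h2

/-- `μ(v) ψ(v) = -(3 / 2) Q(v) v`: the symmetry of `ψ` in the envelope makes
`μ(v, v) ψ(v) - μ(v, ψ(v)) v` a combination of values of the form, and its second term is `0`. -/
theorem IsSpecial.extend_rho_covMu_covPsi (hr : r.IsSpecial h2) (h3 : (3 : k) ≠ 0) {v : ι → V}
    (hv : ∀ i, v i ∈ 𝒱 (γ i)) :
    extend ε γ r.rho (hat r.covMu v) (hat r.covPsi v)
      = (-(3 / 2) : k) •
        extend ε γ (LinearMap.lsmul k V : k →ₗ[k] V →ₗ[k] V) (hat r.covQ v)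
          (hat (idMap k V) v) := by
  have hid := hat_idMap_isHomog (𝒱 := 𝒱) hv
  have hP := hat_covPsi_isHomog (r := r) hv
  have ho : Odd 3 := by decide
  have e1 := hr.extend_rho_moment h3 odd_one ho hid hid hP
  have e2 := hr.extend_rho_moment h3 ho odd_one hid hP hid
  have hsw : convo ε γ (fun J M => convo ε γ (fun K N =>
        r.covPsi ![hat (idMap k V) v J, hat (idMap k V) v K, hat r.covPsi v N]) M)
      = convo ε γ (fun J M => convo ε γ (fun K N =>
        r.covPsi ![hat (idMap k V) v J, hat r.covPsi v K, hat (idMap k V) v N]) M) := by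
    refine congrArg (convo ε γ) (funext fun J => funext fun M => ?_)
    have hz : ∀ a b : V, r.covPsi ![a, b, 0] = 0 := fun a b => r.covPsi.map_coord_zero 2 rfl
    have hz' : ∀ a b : V, r.covPsi ![a, 0, b] = 0 := fun a b => r.covPsi.map_coord_zero 1 rfl
    have h := convo_swap (ε := ε) (γ := γ) (1 : k)
      (F := fun K N => r.covPsi ![hat (idMap k V) v J, hat (idMap k V) v K, hat r.covPsi v N])
      (G := fun K N => r.covPsi ![hat (idMap k V) v J, hat r.covPsi v K, hat (idMap k V) v N])
      fun K N => ?_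
    · rw [one_smul] at h
      exact congrFun h M
    by_cases hK : K.card = 1
    · by_cases hN : N.card = 3
      · rw [swapFactor_of_odd (hK ▸ odd_one) (hN ▸ ho), one_mul, neg_smul]
        exact r.covPsi_swap_right (hid J).1 (hid K).1 (hP N).1
      · simp only [(hP N).2 hN, hz, hz', smul_zero]
    · simp only [(hid K).2 hK, hz, hz', smul_zero]
  rw [extend_moment_id_covPsi h2 hv, extend_zero_left, ← hsw, r.extend_form_self h2 odd_one hid,
    extend_zero_left, r.extend_form_antisymm ho odd_one hP hid,
    hr.extend_form_id_covPsi h3 hv, ← neg_one_smul k (hat r.covQ v), extend_smul_left] at e2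
  rw [r.extend_moment_id_id hv, extend_smul_left, hr.extend_form_id_covPsi h3 hv] at e1
  generalize extend ε γ (LinearMap.lsmul k V : k →ₗ[k] V →ₗ[k] V) (hat r.covQ v)
    (hat (idMap k V) v) = q at *
  generalize (1 / 3 : k) • convo ε γ (fun J M => convo ε γ (fun K N =>
    r.covPsi ![hat (idMap k V) v J, hat (idMap k V) v K, hat r.covPsi v N]) M) = c at *
  have hc : c = -q := by
    have := e2.symm
    rw [neg_one_smul, sub_zero, sub_neg_eq_add] at this
    exact eq_neg_of_add_eq_zero_left this
  have h : (2 : k) • extend ε γ r.rho (hat r.covMu v) (hat r.covPsi v)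
      = (2 : k) • ((-(3 / 2) : k) • q) := by
    rw [e1, hc, smul_smul, show (2 : k) * -(3 / 2) = -3 by field_simp]
    module
  exact smul_right_injective _ h2 h

/-- `μ(ψ(v), ψ(v)) = 3 Q(v) μ(v)`, from `[μ(v), μ(v, ψ(v))] = 0` and equivariance. -/
theorem IsSpecial.extend_moment_covPsi_covPsi (hr : r.IsSpecial h2) (h3 : (3 : k) ≠ 0) {v : ι → V}
    (hv : ∀ i, v i ∈ 𝒱 (γ i)) :
    extend ε γ r.moment (hat r.covPsi v) (hat r.covPsi v)
      = (3 : k) •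
        extend ε γ (LinearMap.lsmul k L : k →ₗ[k] L →ₗ[k] L) (hat r.covQ v) (hat r.covMu v) := by
  have hid := hat_idMap_isHomog (𝒱 := 𝒱) hv
  have hM := hat_covMu_isHomog (r := r) hv
  have hP := hat_covPsi_isHomog (r := r) hv
  have h := r.extend_bracket_moment even_two hM hid hP
  have hMP : IsHomog γ 𝒱 (2 + 3) (extend ε γ r.rho (hat r.covMu v) (hat r.covPsi v)) :=
    hM.extend (fun _ _ _ hx _ hw => r.rho_apply_mem hx hw) hP
  have hassoc := extend_assoc (ε := ε) (γ := γ) r.moment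
    (LinearMap.lsmul k V : k →ₗ[k] V →ₗ[k] V) (LinearMap.lsmul k L : k →ₗ[k] L →ₗ[k] L) r.moment
    (fun a b c => by simp) (hat r.covQ v) (hat (idMap k V) v) (hat (idMap k V) v)
  rw [extend_moment_id_covPsi h2 hv, extend_zero_right, r.extend_rho_covMu_id hv,
    r.extend_moment_symm odd_one (by decide) hid hMP, hr.extend_rho_covMu_covPsi h3 hv,
    extend_smul_left, hassoc, r.extend_moment_id_id hv, extend_smul_right, smul_smul] at h
  rw [eq_neg_of_add_eq_zero_left h.symm, ← neg_smul]
  congr 1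
  field_simp

/-- `ψ(ψ, ψ, ψ) = 3 μ(ψ, ψ) ψ`, because the form vanishes on `(ψ, ψ)` for an odd element `ψ`. -/
theorem IsSpecial.convo_covPsi (hr : r.IsSpecial h2) (h3 : (3 : k) ≠ 0) {v : ι → V}
    (hv : ∀ i, v i ∈ 𝒱 (γ i)) :
    convo ε γ (fun J M => convo ε γ (fun K N =>
        r.covPsi ![hat r.covPsi v J, hat r.covPsi v K, hat r.covPsi v N]) M)
      = (3 : k) • extend ε γ r.rho (extend ε γ r.moment (hat r.covPsi v) (hat r.covPsi v))
        (hat r.covPsi v) := by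
  have hP := hat_covPsi_isHomog (r := r) hv
  have ho : Odd 3 := by decide
  rw [hr.extend_rho_moment h3 ho ho hP hP hP, r.extend_form_self h2 ho hP, extend_zero_left,
    sub_zero, sub_zero, smul_smul, mul_one_div_cancel h3, one_smul]

/-- `ψ(ψ, ψ, ψ) = -(27 / 2) Q ^ 2 v`. -/
theorem IsSpecial.convo_covPsi_eq_covQ (hr : r.IsSpecial h2) (h3 : (3 : k) ≠ 0) {v : ι → V}
    (hv : ∀ i, v i ∈ 𝒱 (γ i)) :
    convo ε γ (fun J M => convo ε γ (fun K N =>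
        r.covPsi ![hat r.covPsi v J, hat r.covPsi v K, hat r.covPsi v N]) M)
      = (-(27 / 2) : k) • extend ε γ (LinearMap.lsmul k V : k →ₗ[k] V →ₗ[k] V)
        (extend ε γ (LinearMap.lsmul k k : k →ₗ[k] k →ₗ[k] k) (hat r.covQ v) (hat r.covQ v))
        (hat (idMap k V) v) := by
  rw [hr.convo_covPsi h3 hv, hr.extend_moment_covPsi_covPsi h3 hv, extend_smul_left,
    extend_assoc r.rho (LinearMap.lsmul k L : k →ₗ[k] L →ₗ[k] L)
      (LinearMap.lsmul k V : k →ₗ[k] V →ₗ[k] V) r.rho (fun a b c => by simp),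
    hr.extend_rho_covMu_covPsi h3 hv, extend_smul_right,
    ← extend_assoc (LinearMap.lsmul k V : k →ₗ[k] V →ₗ[k] V)
      (LinearMap.lsmul k k : k →ₗ[k] k →ₗ[k] k) (LinearMap.lsmul k V : k →ₗ[k] V →ₗ[k] V)
      (LinearMap.lsmul k V : k →ₗ[k] V →ₗ[k] V)
      (fun a b c => by simp only [LinearMap.lsmul_apply, smul_eq_mul, mul_smul]),
    smul_smul, smul_smul]
  congr 1
  ring

/-- `4 (ψ, ψ(ψ, ψ, ψ)) = 54 Q ^ 3`. -/
theorem IsSpecial.extend_form_covPsi_convo (hr : r.IsSpecial h2) (h3 : (3 : k) ≠ 0) {v : ι → V}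
    (hv : ∀ i, v i ∈ 𝒱 (γ i)) :
    (4 : k) • extend ε γ r.form (hat r.covPsi v)
        (convo ε γ (fun J M => convo ε γ (fun K N =>
          r.covPsi ![hat r.covPsi v J, hat r.covPsi v K, hat r.covPsi v N]) M))
      = (54 : k) • extend ε γ (LinearMap.lsmul k k : k →ₗ[k] k →ₗ[k] k)
        (extend ε γ (LinearMap.lsmul k k : k →ₗ[k] k →ₗ[k] k) (hat r.covQ v) (hat r.covQ v))
        (hat r.covQ v) := by
  have hP := hat_covPsi_isHomog (r := r) hv
  have hX : IsHomog γ 𝒱 9 (extend ε γ r.rho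
      (extend ε γ r.moment (hat r.covPsi v) (hat r.covPsi v)) (hat r.covPsi v)) :=
    (hP.extend (𝒯 := 𝔤) (fun _ _ _ hx _ hw => r.moment_mem hx hw) hP).extend
      (fun _ _ _ hx _ hw => r.rho_apply_mem hx hw) hP
  -- `ψ(ψ, ψ, ψ)` is odd of length `9`, which allows the exchange with `ψ`
  rw [hr.convo_covPsi h3 hv, extend_smul_right,
    r.extend_form_antisymm (by decide) (by decide) hP hX,
    ← neg_one_smul k, smul_comm (3 : k), ← extend_smul_left, ← hr.convo_covPsi h3 hv,
    hr.convo_covPsi_eq_covQ h3 hv, extend_smul_left,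
    extend_assoc r.form (LinearMap.lsmul k V : k →ₗ[k] V →ₗ[k] V)
      (LinearMap.lsmul k k : k →ₗ[k] k →ₗ[k] k) r.form (fun a b c => by simp),
    hr.extend_form_id_covPsi h3 hv, smul_smul, smul_smul]
  congr 1
  field_simp
  ring

theorem extComp_covMu_covPsi_apply {γ : Fin 6 → Γ} {v : Fin 6 → V} (hv : ∀ i, v i ∈ 𝒱 (γ i)) :
    extComp (i := 2) (j := 3) ε 𝒱 r.covMu r.covPsi v
      = extend ε γ r.moment (hat r.covPsi v) (hat r.covPsi v) univ := by
  rw [extComp_apply_eq_multiConvo (i := 2) (j := 3) r.covMu r.covPsi v hv, multiConvo_two]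
  simp only [covMu_apply]
  rfl

theorem extComp_covPsi_covPsi_apply {γ : Fin 9 → Γ} {v : Fin 9 → V} (hv : ∀ i, v i ∈ 𝒱 (γ i)) :
    extComp (i := 3) (j := 3) ε 𝒱 r.covPsi r.covPsi v
      = convo ε γ (fun J M => convo ε γ (fun K N =>
        r.covPsi ![hat r.covPsi v J, hat r.covPsi v K, hat r.covPsi v N]) M) univ := by
  rw [extComp_apply_eq_multiConvo (i := 3) (j := 3) r.covPsi r.covPsi v hv, multiConvo_three]
  refine congrFun (congrArg (convo ε γ) (funext fun J => funext fun M =>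
    congrFun (congrArg (convo ε γ) (funext fun K => funext fun N => congrArg r.covPsi ?_)) M)) _
  funext i; fin_cases i <;> rfl

theorem IsSpecial.extComp_covQ_covPsi_apply (hr : r.IsSpecial h2) (h3 : (3 : k) ≠ 0)
    {γ : Fin 12 → Γ} {v : Fin 12 → V} (hv : ∀ i, v i ∈ 𝒱 (γ i)) :
    extComp (i := 4) (j := 3) ε 𝒱 r.covQ r.covPsi v
      = ((4 : k) • extend ε γ r.form (hat r.covPsi v)
        (convo ε γ (fun J M => convo ε γ (fun K N =>
          r.covPsi ![hat r.covPsi v J, hat r.covPsi v K, hat r.covPsi v N]) M))) univ := by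
  have hP := hat_covPsi_isHomog (r := r) hv
  rw [extComp_apply_eq_multiConvo (i := 4) (j := 3) r.covQ r.covPsi v hv, multiConvo_four]
  have e : ∀ (J : Finset (Fin 12)) (𝒥 : Fin 3 → Finset (Fin 12)),
      r.covQ (fun i => hat r.covPsi v ((![J, 𝒥 0, 𝒥 1, 𝒥 2] : Fin 4 → Finset (Fin 12)) i))
      = 4 * r.form (hat r.covPsi v J)
        (r.covPsi ![hat r.covPsi v (𝒥 0), hat r.covPsi v (𝒥 1), hat r.covPsi v (𝒥 2)]) := by
    intro J 𝒥
    rw [← hr.covQ_eq h3 (hP J).1 (hP _).1 (hP _).1 (hP _).1]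
    congr 1
    funext i; fin_cases i <;> rfl
  simp only [e, multiConvo_three]
  rw [extend, ← convo_smul]
  refine congrFun (congrArg (convo ε γ) (funext fun J => funext fun M => ?_)) _
  rw [map_convo (r.form (hat r.covPsi v J)), ← Pi.smul_apply, ← convo_smul]
  refine congrFun (congrArg (convo ε γ) (funext fun K => funext fun N => ?_)) _
  rw [map_convo (r.form (hat r.covPsi v J)), ← Pi.smul_apply, ← convo_smul]
  rfl

end OrthogonalRep

end Generic

end ColourLie

open ColourLie in
theorem mainTheorem3 {k Γ L V : Type*} [Field k] (h2 : (2 : k) ≠ 0) (h3 : (3 : k) ≠ 0)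
    [AddCommGroup Γ] [DecidableEq Γ]
    [AddCommGroup L] [Module k L] [FiniteDimensional k L]
    [AddCommGroup V] [Module k V] [FiniteDimensional k V]
    (ε : CommutationFactor Γ k)
    (𝔤 : Γ → Submodule k L) [DirectSum.Decomposition 𝔤]
    (𝒱 : Γ → Submodule k V) [DirectSum.Decomposition 𝒱]
    (A : QuadraticColourLieAlgebra ε 𝔤) (r : OrthogonalRep A.toColourLieAlgebra 𝒱)
    (hr : r.IsSpecial h2) :
    -- the covariants are `ε`-alternating
    (IsAlt ε 𝒱 r.covMu ∧ IsAlt ε 𝒱 r.covPsi ∧ IsAlt ε 𝒱 r.covQ) ∧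
    -- `μ ∧_ρ ψ = -(3/2) Q ∧_× Id` in `Alt^5(V, V)`
    (IsAlt ε 𝒱 (wedge ε 𝒱 r.rho r.covMu r.covPsi) ∧
      IsAlt ε 𝒱 (wedgeSmul ε 𝒱 r.covQ (idMap k V)) ∧
      (wedge ε 𝒱 r.rho r.covMu r.covPsi : MultilinearMap k (fun _ : Fin 5 => V) V)
        = (-(3 / 2) : k) • wedgeSmul ε 𝒱 r.covQ (idMap k V)) ∧
    -- `μ ∘ ψ = 3 Q ∧_× μ` in `Alt^6(V, 𝔤)`
    (IsAlt ε 𝒱 (extComp ε 𝒱 r.covMu r.covPsi) ∧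
      IsAlt ε 𝒱 (wedgeSmul ε 𝒱 r.covQ r.covMu) ∧
      (extComp ε 𝒱 r.covMu r.covPsi : MultilinearMap k (fun _ : Fin 6 => V) L)
        = (3 : k) • wedgeSmul ε 𝒱 r.covQ r.covMu) ∧
    -- `ψ ∘ ψ = -(27/2) Q ∧_ε Q ∧_× Id` in `Alt^9(V, V)`
    (IsAlt ε 𝒱 (extComp ε 𝒱 r.covPsi r.covPsi) ∧
      IsAlt ε 𝒱 (wedgeSmul ε 𝒱 (wedgeSmul ε 𝒱 r.covQ r.covQ) (idMap k V)) ∧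
      (extComp ε 𝒱 r.covPsi r.covPsi : MultilinearMap k (fun _ : Fin 9 => V) V)
        = (-(27 / 2) : k) •
          wedgeSmul ε 𝒱 (wedgeSmul ε 𝒱 r.covQ r.covQ) (idMap k V)) ∧
    -- `Q ∘ ψ = 54 Q ∧_ε Q ∧_ε Q` in `Alt^12(V, k)`
    (IsAlt ε 𝒱 (extComp ε 𝒱 r.covQ r.covPsi) ∧
      IsAlt ε 𝒱 (wedgeSmul ε 𝒱 (wedgeSmul ε 𝒱 r.covQ r.covQ) r.covQ) ∧
      (extComp ε 𝒱 r.covQ r.covPsi : MultilinearMap k (fun _ : Fin 12 => V) k)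
        = (54 : k) • wedgeSmul ε 𝒱 (wedgeSmul ε 𝒱 r.covQ r.covQ) r.covQ) := by
  have hμ := r.isAlt_covMu
  have hψ := r.isAlt_covPsi
  have hQ := hr.isAlt_covQ h3
  have hid : IsAlt ε 𝒱 (idMap k V) := isAlt_of_le_one le_rfl ε 𝒱 _
  have hQQ : IsAlt ε 𝒱 (wedgeSmul ε 𝒱 r.covQ r.covQ) := hQ.wedge _ hQ
  refine ⟨⟨hμ, hψ, hQ⟩, ⟨hμ.wedge _ hψ, hQ.wedge _ hid, ?_⟩, ⟨hψ.extComp _, hQ.wedge _ hμ, ?_⟩,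
    ⟨hψ.extComp _, hQQ.wedge _ hid, ?_⟩, ⟨hψ.extComp _, hQQ.wedge _ hQ, ?_⟩⟩
  · refine multilinear_ext_homogeneous 𝒱 fun γ v hv => ?_
    have h := hr.extend_rho_covMu_covPsi h3 hv
    rw [smul_apply, apply_eq_hat (wedge ε 𝒱 r.rho r.covMu r.covPsi), wedgeSmul,
      apply_eq_hat (wedge ε 𝒱 _ r.covQ (idMap k V)), hat_wedge _ _ _ v hv, hat_wedge _ _ _ v hv]
    exact congrFun h _
  · refine multilinear_ext_homogeneous 𝒱 fun γ v hv => ?_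
    have h := hr.extend_moment_covPsi_covPsi h3 hv
    rw [smul_apply, OrthogonalRep.extComp_covMu_covPsi_apply hv, wedgeSmul,
      apply_eq_hat (wedge ε 𝒱 _ r.covQ r.covMu), hat_wedge _ _ _ v hv]
    exact congrFun h _
  · refine multilinear_ext_homogeneous 𝒱 fun γ v hv => ?_
    have h := hr.convo_covPsi_eq_covQ h3 hv
    rw [smul_apply, OrthogonalRep.extComp_covPsi_covPsi_apply hv, wedgeSmul, wedgeSmul,
      apply_eq_hat (wedge ε 𝒱 _ _ (idMap k V)), hat_wedge _ _ _ v hv, hat_wedge _ _ _ v hv]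
    exact congrFun h _
  · refine multilinear_ext_homogeneous 𝒱 fun γ v hv => ?_
    have h := hr.extend_form_covPsi_convo h3 hv
    rw [smul_apply, hr.extComp_covQ_covPsi_apply h3 hv, wedgeSmul, wedgeSmul,
      apply_eq_hat (wedge ε 𝒱 _ _ r.covQ), hat_wedge _ _ _ v hv, hat_wedge _ _ _ v hv]
    exact congrFun h _
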